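/- Let $G=(V_G,E_G)$ be a digraph without loops (possibly infinite), $R$ a commutative ring with unit, $K$ a field of characteristic $0$. **Path chains.** Let $\Lambda_n(R)$ ($n\ge 0$) be the free $R$-module on all sequences $e_{v_0,\dots,v_n}$ in $V_G$, $\Lambda_n(R)=0$ for $n<0$, with $\partial e_{v_0,\dots,v_n}=\sum_i(-1)^ie_{v_0,\dots,\hat v_i,\dots,v_n}$ for $n\ge1$ and $\partial=0$ for $n=0$. Let $\mathcal A_n(G;R)$ be the span of the $n$-paths of $G$ (all $(v_{i-1},v_i)\in E_G$), and $\Omega_n(G;R)$ the set of $x\in\mathcal A_n(G;R)$ such that $\partial x$ is in $\mathcal A_{n-1}(G;R)$ modulo sequences with two equal consecutive entries. The head set $\bar h(x)$ of $x$ is the set of last vertices of the paths with nonzero coefficient in $x$; $x$ is upper connected with head $h(x)$ if $\bar h(x)=\{h(x)\}$. Let $\delta^h_u$ be the linear map that sends $e_{v_0,\dots,v_n}$ to $e_{v_0,\dots,v_{n-1}}$ if $n\ge1$ and $v_{n-1}=u$, and to $0$ otherwise. The upper extension $[x]^v$ is the linear extension of $e_{v_0,\dots,v_n}\mapsto e_{v_0,\dots,v_n,v}$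 if this is a path of $G$, and $\mapsto 0$ otherwise. **Face multihypergraphs.** An upper face multihypergraph $F$ on $x_1,\dots,x_m\in\Omega_n(G;R)$, where $x_i\ne-x_j$ for $i\ne j$, consists of vertices $1,\dots,m$ (labelled $x_1,\dots,x_m$); for each $i$ and $u\in V_G$, a decomposition $\delta^h_u(x_i)=x_i^{u,1}+\dots+x_i^{u,m_i^u}$ with terms in $\Omega_{n-1}(G;R)$, no nonempty subsequence of which sums to $0$; and hyperedges, each labelled by some $u\in V_G$ and a set of terms $x_i^{u,k}$ (regarded as indexed by $(i,k)$) and joining the vertices $i$ that occur. A label is either a pair $x_i^{u,k}=-x_j^{u,l}$ with $i\ne j$, or a set of $t\ge3$ terms, not all with the same $i$, that are all equal and sum to $0$. Each $x_i^{u,k}$ lies in at most one label. A mutation of $F$ is a face multihypergraph with the same vertices and decompositions that is obtained by regrouping the members of two labels of equal size $t\ge 2$ and with the same $u$ into two labels of size $t$, or by replacing two labels of equal size $t\ge3$ and with the same $u$ by $t$ pairs that match the members of one with those of the other, or by the reverse of this. $F$ is strongly connected if every face multihypergraph obtained from it by finitely many (possibly zero) mutations is connected. For $v\in V_G$, $[x_1+\dots+x_m]^v$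 is an upper extension over $F$ if $(w,v)\in E_G$ for all $i$ and $w\in\bar h(x_i)$. It is $v$-complete if every hyperedge label has $u\neq v$ and $(u,v)\notin E_G$, and if, conversely, for all $i$ and all $u\ne v$ with $\delta^h_u(x_i)\ne0$ and $(u,v)\notin E_G$, every $x_i^{u,k}$, $1\le k\le m_i^u$, lies in a label. **Inductive elements.** Let $\bar E^h_{-1}=\emptyset$ and $\bar E^h_0=\{\pm e_v\mid v\in V_G\}$. For $n\ge1$ let $\bar E^h_n=\bar E^h_n(G;R)$ be the set of upper connected $x\in\Omega_n(G;R)$ that are upper extensions $[x_1+\dots+x_m]^{h(x)}$ over some strongly connected, $h(x)$-complete upper face multihypergraph on $x_1,\dots,x_m\in\Omega_{n-1}(G;R)$ such that each $x_i$ is up to sign in $\bar E^h_{n-1}$ and each $x_i^{u,k}$ is up to sign in $\bar E^h_{n-2}$. These are the $n$-dimensional upper inductive elements. The set $\bar E^t_n(G;R)$ of lower inductive elements is defined in the same way with heads replaced by tails (first vertices), extension at the end of a path by extension at its beginning, and all edges $(u,v)$, $(w,v)$ in the conditions by $(v,u)$, $(v,w)$. **Statement.** For $\bar E_n=\bar E_n^h$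 and likewise for $\bar E_n=\bar E_n^t$: 1. For $i=0,1,2$, $\bar E_i(G;\mathbb Z)$ contains a $\mathbb Z$-basis of $\Omega_i(G;\mathbb Z)$ and $\bar E_i(G;K)$ contains a $K$-basis of $\Omega_i(G;K)$. 2. $\bar E_3(G;\mathbb Z)$ generates $\Omega_3(G;\mathbb Z)$. 3. A subset of $\bar E_3(G;K)$ is a $K$-basis of $\Omega_3(G;K)$. Moreover, the bases over $K$ in 1 and 3 can be chosen to consist of images of elements of $\bar E_i(G;\mathbb Z)$, respectively $\bar E_3(G;\mathbb Z)$, under $\Omega_n(G;\mathbb Z)\to\Omega_n(G;K)$. -/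

import Mathlib

namespace PathHom

section Chains

open scoped Classical

/-- The free `R`-module on all finite sequences in `V`. The elementary `n`-path
`e_{v_0,…,v_n}` is the basis vector of the list `[v_0, …, v_n]` of length `n + 1`. -/
abbrev Chains (V R : Type*) [CommRing R] : Type _ := List V →₀ R

/-- The elementary path `e_l`. -/
noncomputable def path {V : Type*} (R : Type*) [CommRing R] (l : List V) : Chains V R :=
  Finsupp.single l 1

/-- The path differential `∂ e_{v_0,…,v_n} = ∑ i, (-1)^i e_{v_0,…,v̂_i,…,v_n}` for `n ≥ 1`;
it vanishes on `0`-paths. -/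
noncomputable def boundary (V R : Type*) [CommRing R] : Chains V R →ₗ[R] Chains V R :=
  Finsupp.linearCombination R fun l : List V =>
    if 2 ≤ l.length then
      ∑ i ∈ Finset.range l.length, (-1 : R) ^ i • path R (l.eraseIdx i)
    else 0

/-- `𝒜_n(G;R)`: the span of the allowed `n`-paths of `G` (zero for `n < 0`). -/
noncomputable def allowed {V : Type*} (G : Digraph V) (R : Type*) [CommRing R] (n : ℤ) :
    Submodule R (Chains V R) :=
  Finsupp.supported R R {l | l ≠ [] ∧ (l.length : ℤ) = n + 1 ∧ l.IsChain G.Adj}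

/-- `ℐ_n(V;R)`: the span of the irregular `n`-paths, those with two equal consecutive
vertices. -/
noncomputable def irregular (V R : Type*) [CommRing R] (n : ℤ) : Submodule R (Chains V R) :=
  Finsupp.supported R R {l | (l.length : ℤ) = n + 1 ∧ ¬ l.IsChain (· ≠ ·)}

/-- `Ω_n(G;R)`: the allowed `x` such that the class of `∂ x` modulo irregular paths is
allowed. Classes of allowed chains are identified with their unique allowed representative. -/
noncomputable def Omega {V : Type*} (G : Digraph V) (R : Type*) [CommRing R] (n : ℤ) :
    Submodule R (Chains V R) :=
  allowed G R n ⊓ (allowed G R (n - 1) ⊔ irregular V R (n - 1)).comap (boundary V R)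

/-- The change of coefficients `Ω_n(G;ℤ) → Ω_n(G;K)`, on all chains. -/
noncomputable def ofInt {V : Type*} (K : Type*) [CommRing K] (x : Chains V ℤ) : Chains V K :=
  Finsupp.mapRange (Int.cast : ℤ → K) Int.cast_zero x

/-- The upper constructions work at the heads of paths, the lower ones at the tails. -/
inductive Side
  | upper
  | lower

/-- The end of a path at the given side: the last vertex for `upper`, the first for `lower`. -/
def Side.endpoint {V : Type*} : Side → List V → Option V
  | .upper, l => l.getLast?
  | .lower, l => l.head?

/-- A path with the vertex at the given side removed. -/
def Side.truncate {V : Type*} : Side → List V → List V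
  | .upper, l => l.dropLast
  | .lower, l => l.tail

/-- A path with the vertex `v` added at the given side. -/
def Side.add {V : Type*} : Side → V → List V → List V
  | .upper, v, l => l ++ [v]
  | .lower, v, l => v :: l

/-- `(u,v) ∈ E_G` in the upper case, `(v,u) ∈ E_G` in the lower case. -/
def Side.Joins {V : Type*} (G : Digraph V) : Side → V → V → Prop
  | .upper, u, v => G.Adj u v
  | .lower, u, v => G.Adj v u

/-- The head set (`upper`) or tail set (`lower`) of a chain. -/
def endSet {V R : Type*} [CommRing R] (s : Side) (x : Chains V R) : Set V :=
  {v | ∃ l ∈ x.support, s.endpoint l = some v}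

/-- `δ^h_{n,u}` (`upper`): `e_{v_0,…,v_n}` goes to `e_{v_0,…,v_{n-1}}` if `v_{n-1} = u` and to
`0` otherwise. `δ^t_{n,u}` (`lower`): `e_{v_0,…,v_n}` goes to `e_{v_1,…,v_n}` if `v_1 = u` and
to `0` otherwise. Both vanish on `0`-paths. -/
noncomputable def face {V : Type*} (R : Type*) [CommRing R] (s : Side) (u : V) :
    Chains V R →ₗ[R] Chains V R :=
  Finsupp.linearCombination R fun l : List V =>
    if s.endpoint (s.truncate l) = some u then path R (s.truncate l) else 0

/-- The upper extension `[x]^v` or the lower extension `[x]_v`: each path is extended by `v`,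
and those that are then not paths of `G` are dropped. -/
noncomputable def extend {V : Type*} (G : Digraph V) (R : Type*) [CommRing R] (s : Side) (v : V) :
    Chains V R →ₗ[R] Chains V R :=
  Finsupp.linearCombination R fun l : List V =>
    if (s.add v l).IsChain G.Adj then path R (s.add v l) else 0

end Chains

/-- The vertices and the face decompositions of a face multihypergraph on a sequence
`x_1,…,x_m` of elements of `Ω_n(G;R)` with `x_i ≠ -x_j` for `i ≠ j`: for each `u` and `i`, a
sequence `x_i^{u,1},…,x_i^{u,m_i^u}` in `Ω_{n-1}(G;R)` with sum `δ_{n,u}(x_i)`, no nonempty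
subsequence of which sums to zero (so it is empty when `δ_{n,u}(x_i) = 0`).
Here `mult u i = m_i^u`, and `part u i k` for `k < mult u i` are the `x_i^{u,k}`. -/
structure FaceDecomposition {V : Type*} (G : Digraph V) (R : Type*) [CommRing R] (s : Side)
    (n : ℤ) {m : ℕ} (x : Fin m → Chains V R) where
  vertex_mem : ∀ i, x i ∈ Omega G R n
  vertex_ne_neg : ∀ i j, i ≠ j → x i ≠ -x j
  mult : V → Fin m → ℕ
  part : V → Fin m → ℕ → Chains V R
  part_mem : ∀ u i k, k < mult u i → part u i k ∈ Omega G R (n - 1)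
  sum_part : ∀ u i, ∑ k ∈ Finset.range (mult u i), part u i k = face R s u (x i)
  sum_ne_zero : ∀ u i (T : Finset ℕ), T ⊆ Finset.range (mult u i) → T.Nonempty →
    ∑ k ∈ T, part u i k ≠ 0

/-- A label of a hyperedge: the vertex `u` and the set of the `x_i^{u,k}` in the label, each
recorded by its indices `(i,k)`. The hyperedge joins the vertices `i` that occur in it. -/
abbrev Label (V : Type*) (m : ℕ) : Type _ := V × Finset (Fin m × ℕ)

section FaceMultihypergraph

variable {V : Type*} {G : Digraph V} {R : Type*} [CommRing R] {s : Side} {n : ℤ} {m : ℕ}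
  {x : Fin m → Chains V R}

/-- `E` is the set of (labels of) hyperedges of a face multihypergraph with the vertices and
face decompositions `D`. As no `x_i^{u,k}` occurs in two labels, hyperedges are determined by
their labels. -/
structure IsFaceMultihypergraph (D : FaceDecomposition G R s n x) (E : Set (Label V m)) :
    Prop where
  index_lt : ∀ e ∈ E, ∀ p ∈ e.2, p.2 < D.mult e.1 p.1
  edge_or_hyperedge : ∀ e ∈ E,
    (∃ p q : Fin m × ℕ, p.1 ≠ q.1 ∧ e.2 = {p, q} ∧
      D.part e.1 p.1 p.2 = -D.part e.1 q.1 q.2) ∨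
    (3 ≤ e.2.card ∧ (∃ p ∈ e.2, ∃ q ∈ e.2, p.1 ≠ q.1) ∧
      (∀ p ∈ e.2, ∀ q ∈ e.2, D.part e.1 p.1 p.2 = D.part e.1 q.1 q.2) ∧
      ∑ p ∈ e.2, D.part e.1 p.1 p.2 = 0)
  label_disjoint : ∀ e ∈ E, ∀ e' ∈ E, e ≠ e' → e.1 = e'.1 → Disjoint e.2 e'.2

/-- Connectedness of the underlying multihypergraph. -/
def IsConnected (E : Set (Label V m)) : Prop :=
  ∀ i j : Fin m,
    Relation.ReflTransGen (fun i j => ∃ e ∈ E, ∃ p ∈ e.2, ∃ q ∈ e.2, p.1 = i ∧ q.1 = j) i j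

/-- The operations that generate mutations. The first regroups the members of two labels of the
same size `t`, with the same `u`, into two labels of size `t` (for `t = 2` this is the mutation
on edges). The second replaces two labels of the same size `t ≥ 3`, with the same `u`, by `t`
edges that match the members of the one with those of the other. -/
def MutationStep (E E' : Set (Label V m)) : Prop :=
  (∃ (u : V) (a b a' b' : Finset (Fin m × ℕ)),
    (u, a) ∈ E ∧ (u, b) ∈ E ∧ a ≠ b ∧ a.card = b.card ∧
    a'.card = a.card ∧ b'.card = a.card ∧ a' ∪ b' = a ∪ b ∧
    E' = (E \ {(u, a), (u, b)}) ∪ {(u, a'), (u, b')}) ∨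
  (∃ (u : V) (a b : Finset (Fin m × ℕ)) (σ : a ≃ b),
    (u, a) ∈ E ∧ (u, b) ∈ E ∧ a ≠ b ∧ 3 ≤ a.card ∧
    E' = (E \ {(u, a), (u, b)}) ∪
      Set.range fun p : a => (u, {(p : Fin m × ℕ), ((σ p : b) : Fin m × ℕ)}))

/-- Mutation equivalence: the equivalence relation generated by the mutations between face
multihypergraphs with the same vertices and face decompositions. -/
def MutationEquivalent (D : FaceDecomposition G R s n x) :
    Set (Label V m) → Set (Label V m) → Prop :=
  Relation.EqvGen fun E E' =>
    IsFaceMultihypergraph D E ∧ IsFaceMultihypergraph D E' ∧ MutationStep E E'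

/-- All mutation equivalent face multihypergraphs, itself included, are connected. -/
def IsStronglyConnected (D : FaceDecomposition G R s n x) (E : Set (Label V m)) : Prop :=
  ∀ E', MutationEquivalent D E E' → IsConnected E'

/-- The extension of `x_1 + ⋯ + x_m` by `v` is an extension over the face multihypergraph. -/
def ExtendsBy (G : Digraph V) (s : Side) (x : Fin m → Chains V R) (v : V) : Prop :=
  ∀ i, ∀ w ∈ endSet s (x i), s.Joins G w v

/-- `v`-properness. -/
def IsProper (G : Digraph V) (s : Side) (E : Set (Label V m)) (v : V) : Prop :=
  ∀ e ∈ E, ¬ s.Joins G e.1 v ∧ e.1 ≠ v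

/-- `v`-completeness. The `u` with `δ_{n,u}(x_i) ≠ 0` are the heads (tails) of the terms of
`δ_n(x_i) = ∑ u, δ_{n,u}(x_i)`. -/
def IsComplete (D : FaceDecomposition G R s n x) (E : Set (Label V m)) (v : V) : Prop :=
  IsProper G s E v ∧
  ∀ i u, face R s u (x i) ≠ 0 → u ≠ v → ¬ s.Joins G u v →
    ∀ k < D.mult u i, ∃ e ∈ E, e.1 = u ∧ (i, k) ∈ e.2

end FaceMultihypergraph

/-- `y ∈ Ω_n(G;R)` is upper (lower) `(E₁,E₂)`-inductive: it is upper (lower) connected, with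
head (tail) `v`, and it is the extension by `v` over a strongly connected `v`-complete face
multihypergraph whose vertices lie in `E₁` up to sign and whose face decompositions have
their terms in `E₂` up to sign. -/
def IsInductive {V : Type*} (G : Digraph V) (R : Type*) [CommRing R] (s : Side) (n : ℤ)
    (E₁ E₂ : Set (Chains V R)) (y : Chains V R) : Prop :=
  y ∈ Omega G R n ∧
  ∃ v : V, endSet s y = {v} ∧
  ∃ (m : ℕ) (x : Fin m → Chains V R) (D : FaceDecomposition G R s (n - 1) x)
    (E : Set (Label V m)),
    IsFaceMultihypergraph D E ∧ IsStronglyConnected D E ∧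
    ExtendsBy G s x v ∧ IsComplete D E v ∧
    y = extend G R s v (∑ i, x i) ∧
    (∀ i, x i ∈ E₁ ∨ -x i ∈ E₁) ∧
    (∀ u i k, k < D.mult u i → D.part u i k ∈ E₂ ∨ -D.part u i k ∈ E₂)

/-- The set of `n`-dimensional upper (lower) inductive elements. The set in dimension `-1`
is empty. -/
def inductiveElements {V : Type*} (G : Digraph V) (R : Type*) [CommRing R] (s : Side) :
    ℕ → Set (Chains V R)
  | 0 => {y | ∃ v : V, y = path R [v] ∨ y = -path R [v]}
  | 1 => {y | IsInductive G R s 1 (inductiveElements G R s 0) ∅ y}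
  | n + 2 => {y | IsInductive G R s ((n : ℤ) + 2)
      (inductiveElements G R s (n + 1)) (inductiveElements G R s n) y}

/-- `B` is an `R`-basis of the submodule `M`. -/
def IsBasisOf {R A : Type*} [CommRing R] [AddCommGroup A] [Module R A]
    (B : Set A) (M : Submodule R A) : Prop :=
  LinearIndependent R (fun b : B => (b : A)) ∧ Submodule.span R B = M

end PathHom

/-! Let `(x_i)` be a family in `Ω_n` whose faces are sums of signed elementary paths, and suppose
that `∑ x_i` has no face at a vertex `u ≠ v` with `(u,v) ∉ E_G`. In characteristic zero each
elementary path then occurs equally often with either sign among the faces at such `u`, and pairing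
these occurrences gives a `v`-complete face multihypergraph. A mutation does not change which terms
lie in labels, and labels sum to zero, so each connected component of a mutated face multihypergraph
is again a subfamily whose sum extends. Hence a minimal extendable subfamily carries only strongly
connected ones, and every `[∑ x_i]^v` is a sum of inductive elements.

In a digraph without loops each element of `Ω_{n+1}` is the sum over its heads `v` of extensions
`[z_v]^v` with `z_v ∈ Ω_n`. For `n = 2` such a `z_v` is an integral combination of cells: paths
`(a,b,c)`, minus the path `(a,b',c)` through a chosen middle vertex `b'` if `a ≠ c` and
`(a,c) ∉ E_G`. The faces of cells are signed elementary paths, which settles dimension three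
over `ℤ`. A matrix of integers has a kernel over `K` that is spanned by its kernel over `ℤ`, so
`Ω_n(G;K)` is spanned by the image of `Ω_n(G;ℤ)`. Reversing all paths exchanges heads and tails. -/

namespace PathHom

section Supported

variable {α R M : Type*} [CommRing R] [AddCommGroup M] [Module R M] {S : Set α}
  {x : α →₀ R}

theorem map_mem_of_mem_supported {f : (α →₀ R) →ₗ[R] M} {N : Submodule R M}
    (h : ∀ a ∈ S, f (Finsupp.single a 1) ∈ N) (hx : x ∈ Finsupp.supported R R S) : f x ∈ N := by
  suffices Finsupp.supported R R S ≤ N.comap f from this hx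
  rw [Finsupp.supported_eq_span_single, Submodule.span_le]
  rintro _ ⟨a, ha, rfl⟩
  exact h a ha

theorem map_eq_of_mem_supported {f g : (α →₀ R) →ₗ[R] M}
    (h : ∀ a ∈ S, f (Finsupp.single a 1) = g (Finsupp.single a 1))
    (hx : x ∈ Finsupp.supported R R S) : f x = g x :=
  map_mem_of_mem_supported (N := LinearMap.eqLocus f g) (f := .id) h hx

end Supported

section Lists

variable {V : Type*}

/-- The index set of the elementary paths that span `𝒜_n(G;R)`. -/
def allowedLists (G : Digraph V) (n : ℤ) : Set (List V) :=
  {l | l ≠ [] ∧ (l.length : ℤ) = n + 1 ∧ l.IsChain G.Adj}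

/-- The index set of the elementary paths that span `ℐ_n(V;R)`. -/
def irregularLists (V : Type*) (n : ℤ) : Set (List V) :=
  {l | (l.length : ℤ) = n + 1 ∧ ¬ l.IsChain (· ≠ ·)}

end Lists

section ElementaryPaths

variable {V R : Type*} [CommRing R]

theorem boundary_single (l : List V) (r : R) :
    boundary V R (Finsupp.single l r) = if 2 ≤ l.length then
      ∑ i ∈ Finset.range l.length, (-1 : R) ^ i • Finsupp.single (l.eraseIdx i) r else 0 := by
  rw [boundary, Finsupp.linearCombination_single]
  split_ifs
  · simp_rw [Finset.smul_sum, path, smul_comm r, Finsupp.smul_single_one]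
  · exact smul_zero r

open scoped Classical in
theorem face_single (s : Side) (u : V) (l : List V) (r : R) :
    face R s u (Finsupp.single l r) =
      if s.endpoint (s.truncate l) = some u then Finsupp.single (s.truncate l) r else 0 := by
  rw [face, Finsupp.linearCombination_single, smul_ite, smul_zero, path, Finsupp.smul_single_one]

open scoped Classical in
theorem extend_single (G : Digraph V) (s : Side) (v : V) (l : List V) (r : R) :
    extend G R s v (Finsupp.single l r) =
      if (s.add v l).IsChain G.Adj then Finsupp.single (s.add v l) r else 0 := by
  rw [extend, Finsupp.linearCombination_single, smul_ite, smul_zero, path,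
    Finsupp.smul_single_one]

end ElementaryPaths

section Omega

variable {V R : Type*} [CommRing R] {G : Digraph V} {n : ℤ} {x : Chains V R}

theorem mem_Omega_iff : x ∈ Omega G R n ↔ x ∈ Finsupp.supported R R (allowedLists G n) ∧
    boundary V R x ∈
      Finsupp.supported R R (allowedLists G (n - 1) ∪ irregularLists V (n - 1)) := by
  rw [Finsupp.supported_union]
  rfl

theorem boundary_mem_supported_length (hx : x ∈ allowed G R n) :
    boundary V R x ∈ Finsupp.supported R R {l : List V | l ≠ [] ∧ (l.length : ℤ) = n} := by
  refine map_mem_of_mem_supported (fun l hl => ?_) hx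
  obtain ⟨-, hlen, -⟩ := hl
  rw [boundary_single]
  split_ifs with h2
  · refine Submodule.sum_mem _ fun i hi => Submodule.smul_mem _ _ ?_
    have hi' := List.length_eraseIdx_add_one (Finset.mem_range.1 hi)
    refine Finsupp.single_mem_supported R _ ⟨?_, by omega⟩
    rw [ne_eq, ← List.length_eq_zero_iff]
    omega
  · exact zero_mem _

theorem Omega_eq_allowed (hn : n ≤ 1) : Omega G R n = allowed G R n := by
  ext x
  refine ⟨fun hx => hx.1, fun hx => mem_Omega_iff.2 ⟨hx, ?_⟩⟩
  refine Finsupp.supported_mono ?_ (boundary_mem_supported_length hx)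
  rintro l ⟨hl, hlen⟩
  have : l.length = 1 := by have := List.length_pos_iff.2 hl; omega
  obtain ⟨a, rfl⟩ := List.length_eq_one_iff.1 this
  exact .inl ⟨hl, by simpa using hlen, .singleton a⟩

end Omega

/-- An additive map of chains that is compatible with all the structure that enters the
definition of inductive elements. -/
structure IsPathEmbedding {V R R' : Type*} [CommRing R] [CommRing R'] (G G' : Digraph V)
    (s s' : Side) (F : Chains V R →+ Chains V R') : Prop where
  injective : Function.Injective F
  map_mem_Omega : ∀ n x, x ∈ Omega G R n → F x ∈ Omega G' R' n
  face_map : ∀ u x, face R' s' u (F x) = F (face R s u x)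
  extend_map : ∀ v x, extend G' R' s' v (F x) = F (extend G R s v x)
  endSet_map : ∀ x, endSet s' (F x) = endSet s x
  joins_iff : ∀ u v, s'.Joins G' u v ↔ s.Joins G u v
  map_path_singleton : ∀ v, F (path R [v]) = path R' [v]

namespace IsPathEmbedding

variable {V R R' : Type*} [CommRing R] [CommRing R'] {G G' : Digraph V}
  {s s' : Side} {F : Chains V R →+ Chains V R'}

/-- The image of a face decomposition under a path embedding. -/
noncomputable def mapDecomposition (hF : IsPathEmbedding G G' s s' F) {n : ℤ} {m : ℕ}
    {x : Fin m → Chains V R} (D : FaceDecomposition G R s n x) :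
    FaceDecomposition G' R' s' n (fun i => F (x i)) where
  vertex_mem i := hF.map_mem_Omega _ _ (D.vertex_mem i)
  vertex_ne_neg i j h e := D.vertex_ne_neg i j h (hF.injective (by rw [e, map_neg]))
  mult := D.mult
  part u i k := F (D.part u i k)
  part_mem u i k h := hF.map_mem_Omega _ _ (D.part_mem u i k h)
  sum_part u i := by rw [← map_sum, D.sum_part, hF.face_map]
  sum_ne_zero u i T h h' e := D.sum_ne_zero u i T h h'
    (hF.injective (by rw [map_sum, e, map_zero]))

theorem isFaceMultihypergraph_iff (hF : IsPathEmbedding G G' s s' F) {n : ℤ} {m : ℕ}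
    {x : Fin m → Chains V R} (D : FaceDecomposition G R s n x) (E : Set (Label V m)) :
    IsFaceMultihypergraph (hF.mapDecomposition D) E ↔ IsFaceMultihypergraph D E := by
  refine ⟨fun h => ⟨h.index_lt, fun e he => ?_, h.label_disjoint⟩,
    fun h => ⟨h.index_lt, fun e he => ?_, h.label_disjoint⟩⟩ <;>
  simpa only [mapDecomposition, ← map_neg, ← map_sum, hF.injective.eq_iff,
    map_eq_zero_iff F hF.injective] using h.edge_or_hyperedge e he

theorem isStronglyConnected_mapDecomposition (hF : IsPathEmbedding G G' s s' F) {n : ℤ} {m : ℕ}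
    {x : Fin m → Chains V R} {D : FaceDecomposition G R s n x} {E : Set (Label V m)}
    (h : IsStronglyConnected D E) : IsStronglyConnected (hF.mapDecomposition D) E := by
  refine fun E' hE' => h E' (hE'.mono fun A B hAB => ?_)
  rwa [hF.isFaceMultihypergraph_iff, hF.isFaceMultihypergraph_iff] at hAB

theorem isInductive_map (hF : IsPathEmbedding G G' s s' F) {n : ℤ} {E₁ E₂ : Set (Chains V R)}
    {E₁' E₂' : Set (Chains V R')} (h₁ : ∀ x ∈ E₁, F x ∈ E₁') (h₂ : ∀ x ∈ E₂, F x ∈ E₂')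
    {y : Chains V R} (hy : IsInductive G R s n E₁ E₂ y) :
    IsInductive G' R' s' n E₁' E₂' (F y) := by
  obtain ⟨hyΩ, v, hv, m, x, D, E, hE, hconn, hext, hcomp, rfl, hx, hpart⟩ := hy
  refine ⟨hF.map_mem_Omega _ _ hyΩ, v, by rw [hF.endSet_map, hv], m, fun i => F (x i),
    hF.mapDecomposition D, E, (hF.isFaceMultihypergraph_iff D E).2 hE,
    hF.isStronglyConnected_mapDecomposition hconn, fun i w hw => ?_,
    ⟨fun e he => ?_, fun i u hu huv hj => ?_⟩, by rw [← map_sum, hF.extend_map],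
    fun i => (hx i).imp (h₁ _) fun h => map_neg F (x i) ▸ h₁ _ h,
    fun u i k hk => (hpart u i k hk).imp (h₂ _) fun h => map_neg F (D.part u i k) ▸ h₂ _ h⟩
  · rw [hF.endSet_map] at hw
    exact (hF.joins_iff _ _).2 (hext i w hw)
  · rw [hF.joins_iff]
    exact hcomp.1 e he
  · refine hcomp.2 i u (fun h => hu ?_) huv (fun h => hj ((hF.joins_iff _ _).2 h))
    rw [hF.face_map, h, map_zero]

theorem map_mem_inductiveElements (hF : IsPathEmbedding G G' s s' F) (n : ℕ) {y : Chains V R}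
    (hy : y ∈ inductiveElements G R s n) : F y ∈ inductiveElements G' R' s' n := by
  induction n using Nat.strong_induction_on generalizing y with
  | _ n ih =>
    match n with
    | 0 =>
      obtain ⟨v, rfl | rfl⟩ := hy
      · exact ⟨v, .inl (hF.map_path_singleton v)⟩
      · exact ⟨v, .inr (by rw [map_neg, hF.map_path_singleton v])⟩
    | 1 =>
      exact hF.isInductive_map (fun x hx => ih 0 (by omega) hx) (fun x hx => hx.elim) hy
    | n + 2 =>
      exact hF.isInductive_map (fun x hx => ih (n + 1) (by omega) hx)
        (fun x hx => ih n (by omega) hx) hy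

end IsPathEmbedding

section Coefficients

variable {V R R' : Type*} [CommRing R] [CommRing R']

/-- The change of coefficients along a ring homomorphism. -/
noncomputable def mapCoeff (V : Type*) {R R' : Type*} [CommRing R] [CommRing R']
    (φ : R →+* R') : Chains V R →+ Chains V R' :=
  Finsupp.mapRange.addMonoidHom φ.toAddMonoidHom

@[simp]
theorem mapCoeff_apply (φ : R →+* R') (x : Chains V R) (l : List V) :
    mapCoeff V φ x l = φ (x l) := by
  simp [mapCoeff]

@[simp]
theorem mapCoeff_single (φ : R →+* R') (l : List V) (r : R) :
    mapCoeff V φ (Finsupp.single l r) = Finsupp.single l (φ r) := by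
  simp [mapCoeff]

theorem boundary_mapCoeff (φ : R →+* R') (x : Chains V R) :
    boundary V R' (mapCoeff V φ x) = mapCoeff V φ (boundary V R x) := by
  induction x using Finsupp.induction_linear with
  | zero => simp
  | add f g hf hg => simp [hf, hg]
  | single l r =>
    rw [mapCoeff_single, boundary_single, boundary_single]
    split_ifs
    · simp only [Finsupp.smul_single, smul_eq_mul, map_sum, mapCoeff_single, map_mul, map_pow,
        map_neg, map_one]
    · exact (map_zero _).symm

theorem face_mapCoeff (φ : R →+* R') (s : Side) (u : V) (x : Chains V R) :
    face R' s u (mapCoeff V φ x) = mapCoeff V φ (face R s u x) := by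
  induction x using Finsupp.induction_linear with
  | zero => simp
  | add f g hf hg => simp [hf, hg]
  | single l r =>
    rw [mapCoeff_single, face_single, face_single]
    split_ifs
    exacts [(mapCoeff_single ..).symm, (map_zero _).symm]

theorem extend_mapCoeff (G : Digraph V) (φ : R →+* R') (s : Side) (v : V) (x : Chains V R) :
    extend G R' s v (mapCoeff V φ x) = mapCoeff V φ (extend G R s v x) := by
  induction x using Finsupp.induction_linear with
  | zero => simp
  | add f g hf hg => simp [hf, hg]
  | single l r =>
    rw [mapCoeff_single, extend_single, extend_single]
    split_ifs
    exacts [(mapCoeff_single ..).symm, (map_zero _).symm]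

theorem mapCoeff_mem_supported (φ : R →+* R') {S : Set (List V)} {x : Chains V R}
    (hx : x ∈ Finsupp.supported R R S) : mapCoeff V φ x ∈ Finsupp.supported R' R' S := by
  rw [Finsupp.mem_supported'] at hx ⊢
  intro l hl
  rw [mapCoeff_apply, hx l hl, map_zero]

theorem mapCoeff_mem_Omega (G : Digraph V) (φ : R →+* R') {n : ℤ} {x : Chains V R}
    (hx : x ∈ Omega G R n) : mapCoeff V φ x ∈ Omega G R' n := by
  rw [mem_Omega_iff] at hx ⊢
  rw [boundary_mapCoeff]
  exact hx.imp (mapCoeff_mem_supported φ) (mapCoeff_mem_supported φ)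

theorem isPathEmbedding_mapCoeff (G : Digraph V) (s : Side) {φ : R →+* R'}
    (hφ : Function.Injective φ) : IsPathEmbedding G G s s (mapCoeff V φ) where
  injective := Finsupp.mapRange_injective _ (map_zero _) hφ
  map_mem_Omega _ _ h := mapCoeff_mem_Omega G φ h
  face_map := face_mapCoeff φ s
  extend_map := extend_mapCoeff G φ s
  endSet_map x := by
    simp only [endSet, Finsupp.mem_support_iff, mapCoeff_apply, ne_eq, map_eq_zero_iff φ hφ]
  joins_iff _ _ := Iff.rfl
  map_path_singleton v := by rw [path, mapCoeff_single, map_one, path]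

theorem ofInt_eq_mapCoeff (x : Chains V ℤ) : ofInt R x = mapCoeff V (Int.castRingHom R) x :=
  Finsupp.ext fun l => by simp [ofInt]

section IntegralStructure

variable {ι : Type*} [Fintype ι] {b : ι → R} {G : Digraph V} {n : ℤ}

theorem mem_supported_of_sum_smul_ofInt_mem (hb : LinearIndependent ℤ b) {S : Set (List V)}
    {z : ι → Chains V ℤ} (h : ∑ j, b j • ofInt R (z j) ∈ Finsupp.supported R R S) (j : ι) :
    z j ∈ Finsupp.supported ℤ ℤ S := by
  rw [Finsupp.mem_supported'] at h ⊢
  intro l hl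
  refine Fintype.linearIndependent_iff.1 hb (fun i => z i l) ?_ j
  simpa [ofInt, Finsupp.finsetSum_apply, mul_comm] using h l hl

theorem mem_Omega_of_sum_smul_ofInt_mem (hb : LinearIndependent ℤ b) {z : ι → Chains V ℤ}
    (h : ∑ j, b j • ofInt R (z j) ∈ Omega G R n) (j : ι) : z j ∈ Omega G ℤ n := by
  rw [mem_Omega_iff] at h ⊢
  refine ⟨mem_supported_of_sum_smul_ofInt_mem hb h.1 j,
    mem_supported_of_sum_smul_ofInt_mem hb (z := fun j => boundary V ℤ (z j)) ?_ j⟩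
  simpa only [map_sum, map_smul, ofInt_eq_mapCoeff, boundary_mapCoeff] using h.2

-- The coefficients of `x` generate a finitely generated torsion-free, hence free, abelian group.
theorem exists_sum_smul_ofInt_eq [IsAddTorsionFree R] (x : Chains V R) :
    ∃ (m : ℕ) (b : Fin m → R) (z : Fin m → Chains V ℤ),
      LinearIndependent ℤ b ∧ x = ∑ j, b j • ofInt R (z j) := by
  let W := Submodule.span ℤ (x '' x.support)
  have hW (l : List V) : x l ∈ W := by
    by_cases hl : x l = 0
    · rw [hl]
      exact zero_mem W
    · exact Submodule.subset_span ⟨l, Finsupp.mem_support_iff.2 hl, rfl⟩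
  have : Module.Finite ℤ W :=
    Module.Finite.span_of_finite ℤ (x.support.finite_toSet.image x)
  let b := Module.finBasis ℤ W
  let z (j : Fin (Module.finrank ℤ W)) : Chains V ℤ :=
    Finsupp.onFinset x.support (fun l => b.repr ⟨x l, hW l⟩ j) fun l hl => by
      contrapose! hl
      have hx : (⟨x l, hW l⟩ : W) = 0 := Subtype.ext (Finsupp.notMem_support_iff.1 hl)
      rw [hx, map_zero, Finsupp.zero_apply]
  refine ⟨_, fun j => b j, z, b.linearIndependent.map' W.subtype W.ker_subtype, ?_⟩
  ext l
  have h : x l = ∑ j, b.repr ⟨x l, hW l⟩ j • (b j : R) := by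
    simpa only [Submodule.coe_sum, Submodule.coe_smul] using
      congrArg Subtype.val (b.sum_repr ⟨x l, hW l⟩).symm
  rw [h, Finsupp.finsetSum_apply]
  exact Finset.sum_congr rfl fun j _ => by simp [z, ofInt, mul_comm]

theorem Omega_eq_span_ofInt [IsAddTorsionFree R] (G : Digraph V) (n : ℤ) :
    Omega G R n = Submodule.span R (ofInt R '' (Omega G ℤ n : Set (Chains V ℤ))) := by
  apply le_antisymm
  · intro x hx
    obtain ⟨m, b, z, hb, rfl⟩ := exists_sum_smul_ofInt_eq x
    exact Submodule.sum_mem _ fun j _ => Submodule.smul_mem _ _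
      (Submodule.subset_span ⟨z j, mem_Omega_of_sum_smul_ofInt_mem hb hx j, rfl⟩)
  · rw [Submodule.span_le]
    rintro _ ⟨z, hz, rfl⟩
    rw [ofInt_eq_mapCoeff]
    exact mapCoeff_mem_Omega G _ hz

end IntegralStructure

theorem span_ofInt_image_span (B : Set (Chains V ℤ)) :
    Submodule.span R (ofInt R '' (Submodule.span ℤ B : Set (Chains V ℤ))) =
      Submodule.span R (ofInt R '' B) := by
  refine le_antisymm (Submodule.span_le.2 ?_)
    (Submodule.span_mono (Set.image_mono Submodule.subset_span))
  rintro _ ⟨z, hz, rfl⟩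
  suffices Submodule.span ℤ B ≤ ((Submodule.span R (ofInt R '' B)).restrictScalars ℤ).comap
      (mapCoeff V (Int.castRingHom R)).toIntLinearMap by
    rw [ofInt_eq_mapCoeff]
    exact this hz
  rw [Submodule.span_le]
  intro z hz
  exact Submodule.subset_span ⟨z, hz, ofInt_eq_mapCoeff z⟩

theorem ofInt_mem_inductiveElements [CharZero R] {G : Digraph V} {s : Side} {i : ℕ}
    {z : Chains V ℤ} (hz : z ∈ inductiveElements G ℤ s i) :
    ofInt R z ∈ inductiveElements G R s i := by
  rw [ofInt_eq_mapCoeff]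
  exact (isPathEmbedding_mapCoeff G s Int.cast_injective).map_mem_inductiveElements i hz

theorem exists_isBasisOf_of_span_eq (K : Type*) [Field K] [CharZero K] {G : Digraph V} {s : Side}
    {i : ℕ} (h : Submodule.span ℤ (inductiveElements G ℤ s i) = Omega G ℤ i) :
    ∃ B ⊆ inductiveElements G K s i ∩ ofInt K '' inductiveElements G ℤ s i,
      IsBasisOf B (Omega G K i) := by
  obtain ⟨B, hB, hspan, hind⟩ :=
    exists_linearIndependent K (ofInt K '' inductiveElements G ℤ s i)
  refine ⟨B, fun y hy => ⟨?_, hB hy⟩, hind, ?_⟩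
  · obtain ⟨z, hz, rfl⟩ := hB hy
    exact ofInt_mem_inductiveElements hz
  · rw [hspan, Omega_eq_span_ofInt, ← h, span_ofInt_image_span]

end Coefficients

section Reversal

variable {V R : Type*} [CommRing R] {G : Digraph V} {s : Side} {n : ℤ}

/-- The digraph with all edges reversed. -/
def reverseDigraph (G : Digraph V) : Digraph V := ⟨fun a b => G.Adj b a⟩

/-- The other side. -/
def Side.opposite : Side → Side
  | .upper => .lower
  | .lower => .upper

theorem Side.endpoint_reverse (s : Side) (l : List V) :
    s.opposite.endpoint l.reverse = s.endpoint l := by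
  cases s <;> simp [Side.opposite, Side.endpoint]

theorem Side.truncate_reverse (s : Side) (l : List V) :
    s.opposite.truncate l.reverse = (s.truncate l).reverse := by
  cases s <;> simp [Side.opposite, Side.truncate]

theorem Side.add_reverse (s : Side) (v : V) (l : List V) :
    s.opposite.add v l.reverse = (s.add v l).reverse := by
  cases s <;> simp [Side.opposite, Side.add]

theorem Side.joins_opposite (s : Side) (u v : V) :
    s.opposite.Joins G u v ↔ s.Joins (reverseDigraph G) u v := by
  cases s <;> rfl

theorem isChain_reverse_iff {l : List V} :
    l.reverse.IsChain G.Adj ↔ l.IsChain (reverseDigraph G).Adj :=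
  List.isChain_reverse

/-- Reversal of paths, which exchanges the upper and the lower constructions. -/
noncomputable def reverseChains (V R : Type*) [CommRing R] : Chains V R ≃ₗ[R] Chains V R :=
  Finsupp.domLCongr List.reverse_involutive.toPerm

theorem reverseChains_single (l : List V) (r : R) :
    reverseChains V R (Finsupp.single l r) = Finsupp.single l.reverse r :=
  Finsupp.domLCongr_single ..

theorem reverseChains_apply (x : Chains V R) (l : List V) :
    reverseChains V R x l = x l.reverse := rfl

theorem reverseChains_reverseChains (x : Chains V R) :
    reverseChains V R (reverseChains V R x) = x :=
  Finsupp.ext fun l => by rw [reverseChains_apply, reverseChains_apply, List.reverse_reverse]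

theorem reverseChains_mem_supported {S T : Set (List V)} (h : ∀ l ∈ S, l.reverse ∈ T)
    {x : Chains V R} (hx : x ∈ Finsupp.supported R R S) :
    reverseChains V R x ∈ Finsupp.supported R R T := by
  refine map_mem_of_mem_supported (f := (reverseChains V R).toLinearMap) (fun l hl => ?_) hx
  rw [LinearEquiv.coe_coe, reverseChains_single]
  exact Finsupp.single_mem_supported R 1 (h l hl)

theorem reverse_mem_allowedLists {l : List V} (hl : l ∈ allowedLists (reverseDigraph G) n) :
    l.reverse ∈ allowedLists G n :=
  ⟨List.reverse_ne_nil_iff.2 hl.1, by rw [List.length_reverse, hl.2.1],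
    isChain_reverse_iff.2 hl.2.2⟩

theorem reverse_mem_irregularLists {l : List V} (hl : l ∈ irregularLists V n) :
    l.reverse ∈ irregularLists V n := by
  refine ⟨by rw [List.length_reverse, hl.1], fun h => hl.2 ?_⟩
  rw [List.isChain_reverse] at h
  simpa only [ne_comm] using h

theorem eraseIdx_reverse (l : List V) {i : ℕ} (hi : i < l.length) :
    l.reverse.eraseIdx i = (l.eraseIdx (l.length - 1 - i)).reverse := by
  rw [List.eraseIdx_eq_take_drop_succ, List.eraseIdx_eq_take_drop_succ, List.reverse_append,
    List.take_reverse, List.drop_reverse]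
  congr 3 <;> omega

theorem boundary_single_reverse (l : List V) (r : R) :
    boundary V R (Finsupp.single l.reverse r) =
      (-1 : R) ^ (l.length - 1) • reverseChains V R (boundary V R (Finsupp.single l r)) := by
  rw [boundary_single, boundary_single, List.length_reverse]
  split_ifs
  · rw [map_sum, Finset.smul_sum, ← Finset.sum_range_reflect]
    refine Finset.sum_congr rfl fun i hi => ?_
    rw [Finset.mem_range] at hi
    have hsign : (-1 : R) ^ (l.length - 1 - i) = (-1) ^ (l.length - 1) * (-1) ^ i := by
      rw [← pow_add, show l.length - 1 + i = l.length - 1 - i + 2 * i by omega, pow_add, pow_mul,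
        neg_one_sq, one_pow, mul_one]
    rw [map_smul, smul_smul, eraseIdx_reverse l (by omega), reverseChains_single, hsign,
      show l.length - 1 - (l.length - 1 - i) = i by omega]
  · rw [map_zero, smul_zero]

theorem reverseChains_mem_Omega {x : Chains V R} (hx : x ∈ Omega (reverseDigraph G) R n) :
    reverseChains V R x ∈ Omega G R n := by
  rw [mem_Omega_iff] at hx ⊢
  refine ⟨reverseChains_mem_supported (fun l => reverse_mem_allowedLists) hx.1, ?_⟩
  have h : boundary V R (reverseChains V R x) =
      (-1 : R) ^ n.toNat • reverseChains V R (boundary V R x) := by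
    refine map_eq_of_mem_supported (f := boundary V R ∘ₗ (reverseChains V R).toLinearMap)
      (g := (-1 : R) ^ n.toNat • (reverseChains V R).toLinearMap ∘ₗ boundary V R)
      (fun l hl => ?_) hx.1
    have hlen : l.length - 1 = n.toNat := by have := hl.2.1; omega
    rw [LinearMap.comp_apply, LinearEquiv.coe_coe, reverseChains_single, boundary_single_reverse,
      hlen]
    rfl
  rw [h]
  exact Submodule.smul_mem _ _ (reverseChains_mem_supported
    (fun l => Or.imp reverse_mem_allowedLists reverse_mem_irregularLists) hx.2)

theorem face_reverseChains (u : V) (x : Chains V R) :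
    face R s.opposite u (reverseChains V R x) = reverseChains V R (face R s u x) := by
  induction x using Finsupp.induction_linear with
  | zero => simp
  | add f g hf hg => simp [hf, hg]
  | single l r =>
    rw [reverseChains_single, face_single, face_single, s.truncate_reverse, s.endpoint_reverse]
    split_ifs
    exacts [(reverseChains_single ..).symm, (map_zero _).symm]

theorem extend_reverseChains (v : V) (x : Chains V R) :
    extend G R s.opposite v (reverseChains V R x) =
      reverseChains V R (extend (reverseDigraph G) R s v x) := by
  induction x using Finsupp.induction_linear with
  | zero => simp
  | add f g hf hg => simp [hf, hg]
  | single l r =>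
    rw [reverseChains_single, extend_single, extend_single, s.add_reverse]
    by_cases h : (s.add v l).IsChain (reverseDigraph G).Adj
    · rw [if_pos h, if_pos (isChain_reverse_iff.2 h), reverseChains_single]
    · rw [if_neg h, if_neg (h ∘ isChain_reverse_iff.1), map_zero]

theorem endSet_reverseChains (x : Chains V R) :
    endSet s.opposite (reverseChains V R x) = endSet s x := by
  ext v
  simp only [endSet, Finsupp.mem_support_iff, reverseChains_apply, Set.mem_ofPred_eq]
  refine ⟨fun ⟨l, hl, h⟩ => ⟨l.reverse, hl, ?_⟩, fun ⟨l, hl, h⟩ => ⟨l.reverse, ?_, ?_⟩⟩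
  · rw [← s.endpoint_reverse, List.reverse_reverse, h]
  · rwa [List.reverse_reverse]
  · rw [s.endpoint_reverse, h]

theorem isPathEmbedding_reverseChains (G : Digraph V) (R : Type*) [CommRing R] (s : Side) :
    IsPathEmbedding (reverseDigraph G) G s s.opposite
      (reverseChains V R).toLinearMap.toAddMonoidHom where
  injective := (reverseChains V R).injective
  map_mem_Omega _ _ := reverseChains_mem_Omega
  face_map := face_reverseChains
  extend_map := extend_reverseChains
  endSet_map := endSet_reverseChains
  joins_iff := s.joins_opposite
  map_path_singleton v := reverseChains_single [v] 1

theorem map_reverseChains_Omega (G : Digraph V) (R : Type*) [CommRing R] (n : ℤ) :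
    (Omega (reverseDigraph G) R n).map (reverseChains V R).toLinearMap = Omega G R n := by
  refine le_antisymm (Submodule.map_le_iff_le_comap.2 fun x => reverseChains_mem_Omega) ?_
  exact fun x hx => ⟨reverseChains V R x, reverseChains_mem_Omega (G := reverseDigraph G) hx,
    reverseChains_reverseChains x⟩

theorem Omega_le_span_inductiveElements_opposite {i : ℕ}
    (h : Omega (reverseDigraph G) R i ≤
      Submodule.span R (inductiveElements (reverseDigraph G) R s i)) :
    Omega G R i ≤ Submodule.span R (inductiveElements G R s.opposite i) := by
  rw [← map_reverseChains_Omega]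
  refine (Submodule.map_mono h).trans ?_
  rw [Submodule.map_span]
  refine Submodule.span_mono ?_
  rintro _ ⟨x, hx, rfl⟩
  exact (isPathEmbedding_reverseChains G R s).map_mem_inductiveElements i hx

theorem exists_isBasisOf_opposite {i : ℕ}
    (h : ∃ B ⊆ inductiveElements (reverseDigraph G) R s i,
      IsBasisOf B (Omega (reverseDigraph G) R i)) :
    ∃ B ⊆ inductiveElements G R s.opposite i, IsBasisOf B (Omega G R i) := by
  obtain ⟨B, hB, hind, hspan⟩ := h
  refine ⟨(reverseChains V R).toLinearMap '' B, ?_, ?_, ?_⟩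
  · rintro _ ⟨x, hx, rfl⟩
    exact (isPathEmbedding_reverseChains G R s).map_mem_inductiveElements i (hB hx)
  · exact LinearIndepOn.id_image (hind.map' _ (reverseChains V R).ker)
  · rw [← Submodule.map_span, hspan, map_reverseChains_Omega]

end Reversal

section Extension

variable {V R : Type*} [CommRing R] {G : Digraph V} {s : Side} {n : ℤ} {v : V}
  {x z : Chains V R}

/-- The vertices `u` with `u ≠ v` and `(u,v) ∉ E_G` (`(v,u) ∉ E_G` in the lower case): the
extension by `v` of a path whose face ends at `u` has a face that is neither allowed nor
irregular. -/
def IsBlocked (G : Digraph V) (s : Side) (v u : V) : Prop := u ≠ v ∧ ¬ s.Joins G u v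

/-- The chains all of whose elementary paths can be extended by `v`. -/
noncomputable def joined (G : Digraph V) (R : Type*) [CommRing R] (s : Side) (v : V) :
    Submodule R (Chains V R) :=
  Finsupp.supported R R {l | ∀ w, s.endpoint l = some w → s.Joins G w v}

/-- The chains whose faces at the vertices that are blocked for `v` vanish. -/
noncomputable def unblocked (G : Digraph V) (R : Type*) [CommRing R] (s : Side) (v : V) :
    Submodule R (Chains V R) :=
  ⨅ (u) (_ : IsBlocked G s v u), LinearMap.ker (face R s u)

/-- Removal of the head of every path. -/
noncomputable def dropHead (V R : Type*) [CommRing R] : Chains V R →ₗ[R] Chains V R :=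
  Finsupp.lmapDomain R R List.dropLast

/-- Addition of the head `v` to every path, whether or not the result is allowed. -/
noncomputable def addHead (R : Type*) [CommRing R] (v : V) : Chains V R →ₗ[R] Chains V R :=
  Finsupp.lmapDomain R R (· ++ [v])

theorem mem_joined_iff : z ∈ joined G R s v ↔ ∀ w ∈ endSet s z, s.Joins G w v :=
  ⟨fun h w ⟨_, hl, hw⟩ => h hl w hw, fun h _ hl w hw => h w ⟨_, hl, hw⟩⟩

theorem mem_unblocked_iff :
    z ∈ unblocked G R s v ↔ ∀ u, IsBlocked G s v u → face R s u z = 0 := by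
  simp only [unblocked, Submodule.mem_iInf, LinearMap.mem_ker]

theorem dropHead_single (l : List V) (r : R) :
    dropHead V R (Finsupp.single l r) = Finsupp.single l.dropLast r :=
  Finsupp.mapDomain_single

theorem addHead_single (v : V) (l : List V) (r : R) :
    addHead R v (Finsupp.single l r) = Finsupp.single (l ++ [v]) r :=
  Finsupp.mapDomain_single

theorem addHead_apply_concat (v : V) (z : Chains V R) (k : List V) :
    addHead R v z (k ++ [v]) = z k :=
  Finsupp.mapDomain_apply (List.append_left_injective [v]) z k

theorem addHead_apply_of_getLast?_ne (z : Chains V R) {k : List V} (hk : k.getLast? ≠ some v) :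
    addHead R v z k = 0 := by
  refine Finsupp.mapDomain_of_notMem_range _ _ ?_
  rintro ⟨l, rfl⟩
  exact hk List.getLast?_concat

open scoped Classical in
theorem face_upper_apply (u : V) (z : Chains V R) (k : List V) :
    face R .upper u z k = if k.getLast? = some u then dropHead V R z k else 0 := by
  induction z using Finsupp.induction_linear with
  | zero => simp
  | add f g hf hg =>
    rw [map_add, Finsupp.add_apply, hf, hg, map_add, Finsupp.add_apply, ite_add_zero]
  | single l r =>
    rw [face_single, dropHead_single, Side.endpoint, Side.truncate]
    by_cases hk : l.dropLast = k
    · rw [← hk]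
      split_ifs <;> rfl
    · split_ifs <;> simp [hk]

theorem face_upper_eq_zero_iff {u : V} :
    face R .upper u z = 0 ↔ ∀ k : List V, k.getLast? = some u → dropHead V R z k = 0 := by
  simp only [Finsupp.ext_iff, face_upper_apply, Finsupp.zero_apply, ite_eq_right_iff]

theorem dropHead_mem_allowed (hn : 1 ≤ n) (hz : z ∈ allowed G R n) :
    dropHead V R z ∈ allowed G R (n - 1) := by
  refine map_mem_of_mem_supported (S := allowedLists G n) (fun l ⟨_, hlen, hc⟩ => ?_) hz
  rw [dropHead_single]
  refine Finsupp.single_mem_supported R 1 ⟨?_, ?_, hc.dropLast⟩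
  · rw [ne_eq, ← List.length_eq_zero_iff, List.length_dropLast]
    omega
  · rw [List.length_dropLast]
    omega

theorem concat_mem_allowedLists_iff (hn : 1 ≤ n) {k : List V} :
    k ++ [v] ∈ allowedLists G n ↔
      k ∈ allowedLists G (n - 1) ∧ ∀ w ∈ k.getLast?, G.Adj w v := by
  have hk : (k.length : ℤ) = n → k ≠ [] := by
    rintro hk rfl
    rw [List.length_nil] at hk
    omega
  simp only [allowedLists, Set.mem_ofPred_eq, List.isChain_append, List.length_append,
    List.length_singleton, List.head?_cons, Option.mem_some_iff, forall_eq', Nat.cast_add,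
    Nat.cast_one, add_left_inj, sub_add_cancel, ne_eq, List.append_eq_nil_iff]
  grind

theorem concat_mem_irregularLists_iff {k : List V} :
    k ++ [v] ∈ irregularLists V n ↔
      (k.length : ℤ) = n ∧ (k.IsChain (· ≠ ·) → v ∈ k.getLast?) := by
  simp [irregularLists, List.isChain_append]

theorem extend_mem_allowed (hz : z ∈ allowed G R n) (s : Side) (v : V) :
    extend G R s v z ∈ allowed G R (n + 1) := by
  refine map_mem_of_mem_supported (S := allowedLists G n) (fun l hl => ?_) hz
  rw [extend_single]
  split_ifs with hc
  · refine Finsupp.single_mem_supported R 1 ⟨?_, ?_, hc⟩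
    · cases s <;> simp [Side.add]
    · have hlen := hl.2.1
      cases s <;> simpa [Side.add] using hlen
  · exact zero_mem _

theorem extend_upper_eq_addHead (hz : z ∈ allowed G R n) (hv : z ∈ joined G R .upper v) :
    extend G R .upper v z = addHead R v z := by
  have hz' := Submodule.mem_inf.2 ⟨hz, hv⟩
  rw [allowed, joined, ← Finsupp.supported_inter] at hz'
  refine map_eq_of_mem_supported (fun l hl => ?_) hz'
  obtain ⟨⟨-, -, hc⟩, hj⟩ := hl
  rw [extend_single, if_pos, addHead_single, Side.add]
  exact List.isChain_append.2 ⟨hc, .singleton v, by simpa [Side.endpoint, Side.Joins] using hj⟩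

theorem getLast?_eraseIdx {l : List V} {i : ℕ} (hi : i + 1 < l.length) :
    (l.eraseIdx i).getLast? = l.getLast? := by
  rw [List.getLast?_eq_getElem?, List.getLast?_eq_getElem?, List.getElem?_eraseIdx,
    List.length_eraseIdx_of_lt (by omega), if_neg (by omega)]
  congr 1
  omega

theorem boundary_sub_dropHead_mem_supported (hn : 1 ≤ n) {P : Set (Option V)}
    (hz : z ∈ allowed G R n) (hP : z ∈ Finsupp.supported R R {l | l.getLast? ∈ P}) :
    boundary V R z - (-1 : R) ^ n.toNat • dropHead V R z ∈
      Finsupp.supported R R {l | l.getLast? ∈ P} := by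
  have hz' := Submodule.mem_inf.2 ⟨hz, hP⟩
  rw [allowed, ← Finsupp.supported_inter] at hz'
  refine map_mem_of_mem_supported
    (f := boundary V R - (-1 : R) ^ n.toNat • dropHead V R) (fun l hl => ?_) hz'
  obtain ⟨⟨-, hlen, -⟩, hl⟩ := hl
  have hlen' : l.length = n.toNat + 1 := by omega
  rw [LinearMap.sub_apply, LinearMap.smul_apply, dropHead_single, boundary_single,
    if_pos (by omega), hlen', Finset.sum_range_succ, List.eraseIdx_eq_dropLast hlen'.symm,
    add_sub_cancel_right]
  refine Submodule.sum_mem _ fun i hi => Submodule.smul_mem _ _ ?_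
  refine Finsupp.single_mem_supported R 1 ?_
  rw [Set.mem_ofPred_eq, getLast?_eraseIdx]
  · exact hl
  · rw [Finset.mem_range] at hi
    omega

theorem boundary_apply_of_getLast?_notMem (hn : 1 ≤ n) {P : Set (Option V)}
    (hz : z ∈ allowed G R n) (hP : z ∈ Finsupp.supported R R {l | l.getLast? ∈ P}) {k : List V}
    (hk : k.getLast? ∉ P) : boundary V R z k = (-1 : R) ^ n.toNat * dropHead V R z k :=
  sub_eq_zero.1 ((Finsupp.mem_supported' _ _).1 (boundary_sub_dropHead_mem_supported hn hz hP) k hk)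

theorem boundary_apply_of_mem_joined (hn : 1 ≤ n) (hz : z ∈ allowed G R n)
    (hv : z ∈ joined G R .upper v) {k : List V} {u : V} (hk : k.getLast? = some u)
    (hu : ¬ G.Adj u v) : boundary V R z k = (-1 : R) ^ n.toNat * dropHead V R z k :=
  boundary_apply_of_getLast?_notMem (P := {o | ∀ w, o = some w → G.Adj w v}) hn hz hv
    fun h => hu (h u hk)

theorem boundary_addHead (hn : 1 ≤ n) (hz : z ∈ allowed G R n) (v : V) :
    boundary V R (addHead R v z) =
      addHead R v (boundary V R z) + (-1 : R) ^ (n.toNat + 1) • z := by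
  refine map_eq_of_mem_supported (S := allowedLists G n) (f := boundary V R ∘ₗ addHead R v)
    (g := addHead R v ∘ₗ boundary V R + (-1 : R) ^ (n.toNat + 1) • LinearMap.id)
    (fun l hl => ?_) hz
  have hlen : l.length = n.toNat + 1 := by have := hl.2.1; omega
  rw [LinearMap.add_apply, LinearMap.comp_apply, LinearMap.comp_apply, LinearMap.smul_apply,
    LinearMap.id_apply, addHead_single, boundary_single, boundary_single,
    if_pos (by rw [List.length_append]; omega), if_pos (by omega), List.length_append,
    List.length_singleton, Finset.sum_range_succ, List.eraseIdx_append_of_length_le le_rfl,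
    Nat.sub_self, List.eraseIdx_cons_zero, List.append_nil, map_sum, hlen]
  congr 1
  refine Finset.sum_congr rfl fun i hi => ?_
  rw [Finset.mem_range] at hi
  rw [List.eraseIdx_append_of_lt_length (by omega), map_smul, addHead_single]

theorem extend_upper_mem_Omega_iff (hn : 1 ≤ n) (hz : z ∈ allowed G R n)
    (hv : z ∈ joined G R .upper v) :
    extend G R .upper v z ∈ Omega G R (n + 1) ↔
      ∀ k, k ++ [v] ∉ allowedLists G n ∪ irregularLists V n → boundary V R z k = 0 := by
  have hz' : (-1 : R) ^ (n.toNat + 1) • z ∈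
      Finsupp.supported R R (allowedLists G n ∪ irregularLists V n) :=
    Submodule.smul_mem _ _ (Finsupp.supported_mono Set.subset_union_left hz)
  have hext : extend G R .upper v z ∈ Finsupp.supported R R (allowedLists G (n + 1)) :=
    extend_mem_allowed hz .upper v
  rw [mem_Omega_iff, and_iff_right hext, add_sub_cancel_right,
    extend_upper_eq_addHead hz hv, boundary_addHead hn hz, Submodule.add_mem_iff_left _ hz',
    Finsupp.mem_supported']
  refine ⟨fun h k hk => ?_, fun h k hk => ?_⟩
  · rw [← addHead_apply_concat v]
    exact h _ hk
  · by_cases hkv : v ∈ k.getLast?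
    · rw [← List.dropLast_append_getLast? v hkv] at hk ⊢
      rw [addHead_apply_concat]
      exact h _ hk
    · exact addHead_apply_of_getLast?_ne _ hkv

theorem extend_upper_mem_Omega (hn : 1 ≤ n) (hz : z ∈ Omega G R n)
    (hv : z ∈ joined G R .upper v) (hu : z ∈ unblocked G R .upper v) :
    extend G R .upper v z ∈ Omega G R (n + 1) := by
  refine (extend_upper_mem_Omega_iff hn hz.1 hv).2 fun k hk => ?_
  by_cases hkN : k ∈ allowedLists G (n - 1) ∪ irregularLists V (n - 1)
  swap
  · exact (Finsupp.mem_supported' _ _).1 (mem_Omega_iff.1 hz).2 k hkN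
  simp only [Set.mem_union, not_or, concat_mem_allowedLists_iff hn,
    concat_mem_irregularLists_iff] at hk
  obtain ⟨u, hku, hublocked⟩ : ∃ u, k.getLast? = some u ∧ IsBlocked G .upper v u := by
    rcases hkN with hkA | hkI
    · obtain ⟨u, hku, huv⟩ : ∃ u ∈ k.getLast?, ¬ G.Adj u v := by
        by_contra! h
        exact hk.1 ⟨hkA, h⟩
      refine ⟨u, hku, ?_, huv⟩
      rintro rfl
      exact hk.2 ⟨by have := hkA.2.1; omega, fun _ => hku⟩
    · exact absurd ⟨by have := hkI.1; omega, fun h => absurd h hkI.2⟩ hk.2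
  rw [boundary_apply_of_mem_joined hn hz.1 hv hku hublocked.2,
    face_upper_eq_zero_iff.1 (mem_unblocked_iff.1 hu u hublocked) k hku, mul_zero]

section Loopless

variable (hG : ∀ v, ¬ G.Adj v v)

include hG

theorem mem_Omega_of_extend_upper_mem_Omega (hn : 1 ≤ n) (hz : z ∈ allowed G R n)
    (hv : z ∈ joined G R .upper v) (h : extend G R .upper v z ∈ Omega G R (n + 1)) :
    z ∈ Omega G R n := by
  rw [extend_upper_mem_Omega_iff hn hz hv] at h
  refine mem_Omega_iff.2 ⟨hz, (Finsupp.mem_supported' _ _).2 fun k hk => ?_⟩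
  rw [Set.mem_union, not_or] at hk
  by_cases hkv : k.getLast? = some v
  · rw [boundary_apply_of_mem_joined hn hz hv hkv (hG v),
      (Finsupp.mem_supported' _ _).1 (dropHead_mem_allowed hn hz) k hk.1, mul_zero]
  · refine h k ?_
    rw [Set.mem_union, not_or, concat_mem_allowedLists_iff hn, concat_mem_irregularLists_iff]
    refine ⟨fun h => hk.1 h.1, fun h => hkv (h.2 ?_)⟩
    by_contra hreg
    exact hk.2 ⟨by omega, hreg⟩

theorem mem_unblocked_of_extend_upper_mem_Omega (hn : 1 ≤ n) (hz : z ∈ allowed G R n)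
    (hv : z ∈ joined G R .upper v) (h : extend G R .upper v z ∈ Omega G R (n + 1)) :
    z ∈ unblocked G R .upper v := by
  rw [extend_upper_mem_Omega_iff hn hz hv] at h
  refine mem_unblocked_iff.2 fun u hu => face_upper_eq_zero_iff.2 fun k hku => ?_
  by_cases hk : k ∈ allowedLists G (n - 1)
  · have hkv := h k (by
      rw [Set.mem_union, not_or, concat_mem_allowedLists_iff hn, concat_mem_irregularLists_iff]
      refine ⟨fun h => hu.2 (h.2 u hku), fun h => hu.1 ?_⟩
      have hreg : k.IsChain (· ≠ ·) := hk.2.2.imp fun a b hab heq => hG a (by rwa [← heq] at hab)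
      exact Option.some_injective _ (hku.symm.trans (h.2 hreg)))
    rw [boundary_apply_of_mem_joined hn hz hv hku hu.2] at hkv
    exact (isUnit_neg_one.pow n.toNat).mul_right_eq_zero.1 hkv
  · exact (Finsupp.mem_supported' _ _).1 (dropHead_mem_allowed hn hz) k hk

end Loopless

theorem extend_mem_Omega (hz : z ∈ Omega G R n) (hv : z ∈ joined G R s v)
    (hu : z ∈ unblocked G R s v) : extend G R s v z ∈ Omega G R (n + 1) := by
  rcases le_or_gt n 0 with hn | hn
  · rw [Omega_eq_allowed (by omega)]
    exact extend_mem_allowed hz.1 s v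
  cases s with
  | upper => exact extend_upper_mem_Omega hn hz hv hu
  | lower =>
    have hrev := isPathEmbedding_reverseChains (reverseDigraph G) R .lower
    rw [← reverseChains_reverseChains (extend G R .lower v z)]
    refine reverseChains_mem_Omega ?_
    have hext : extend (reverseDigraph G) R .upper v (reverseChains V R z) =
        reverseChains V R (extend G R .lower v z) := hrev.extend_map v z
    rw [← hext]
    refine extend_upper_mem_Omega hn (hrev.map_mem_Omega n z hz) ?_ ?_
    · rw [mem_joined_iff] at hv ⊢
      rwa [← endSet_reverseChains (s := .lower)] at hv
    · rw [mem_unblocked_iff] at hu ⊢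
      intro u hu'
      exact (hrev.face_map u z).trans (by rw [hu u hu', map_zero])

theorem filter_getLast?_mem_Omega (hx : x ∈ Omega G R n) (p : Option V → Prop)
    [DecidablePred fun l : List V => p l.getLast?] :
    (x.filter fun l => p l.getLast?) ∈ Omega G R n := by
  have hfilter (q : List V → Prop) [DecidablePred q] : x.filter q ∈ allowed G R n :=
    (Finsupp.mem_supported' _ _).2 fun l hl => by
      rw [Finsupp.filter_apply, (Finsupp.mem_supported' _ _).1 hx.1 l hl, ite_self]
  rcases le_or_gt n 1 with hn | hn
  · rw [Omega_eq_allowed hn]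
    exact hfilter _
  refine mem_Omega_iff.2 ⟨hfilter _, (Finsupp.mem_supported' _ _).2 fun k hk => ?_⟩
  have hboundary (q : Option V → Prop) [DecidablePred fun l : List V => q l.getLast?]
      (hq : ¬ q k.getLast?) : boundary V R (x.filter fun l => q l.getLast?) k = 0 := by
    have hsupp : (x.filter fun l => q l.getLast?) ∈
        Finsupp.supported R R {l : List V | l.getLast? ∈ {o | q o}} :=
      (Finsupp.mem_supported' _ _).2 fun l hl => Finsupp.filter_apply_neg _ _ hl
    rw [boundary_apply_of_getLast?_notMem hn.le (hfilter _) hsupp hq,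
      (Finsupp.mem_supported' _ _).1 (dropHead_mem_allowed hn.le (hfilter _)) k (hk ∘ Or.inl),
      mul_zero]
  by_cases hpk : p k.getLast?
  · have hx' := (Finsupp.mem_supported' _ _).1 (mem_Omega_iff.1 hx).2 k hk
    rwa [← Finsupp.filter_add_filter_not x fun l => p l.getLast?, map_add, Finsupp.add_apply,
      hboundary (fun o => ¬ p o) (not_not_intro hpk), add_zero] at hx'
  · exact hboundary p hpk

end Extension

section Mutation

variable {V R : Type*} [CommRing R] {G : Digraph V} {s : Side} {n : ℤ} {m : ℕ}
  {x : Fin m → Chains V R} {D : FaceDecomposition G R s n x} {E E' : Set (Label V m)}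

/-- The index triples `(u,(i,k))` of the terms `x_i^{u,k}` that lie in some label of `E`. -/
def coveredTerms (E : Set (Label V m)) : Set (V × Fin m × ℕ) :=
  ⋃ e ∈ E, {e.1} ×ˢ (e.2 : Set (Fin m × ℕ))

theorem mem_coveredTerms {u : V} {p : Fin m × ℕ} :
    (u, p) ∈ coveredTerms E ↔ ∃ a, (u, a) ∈ E ∧ p ∈ a := by
  simp [coveredTerms]

theorem coveredTerms_diff_union {P P' : Set (Label V m)} (hP : P ⊆ E)
    (h : coveredTerms P = coveredTerms P') :
    coveredTerms ((E \ P) ∪ P') = coveredTerms E := by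
  conv_rhs => rw [← Set.sdiff_union_of_subset hP]
  simp only [coveredTerms, Set.biUnion_union] at h ⊢
  rw [h]

theorem MutationStep.coveredTerms_eq (h : MutationStep E E') :
    coveredTerms E = coveredTerms E' := by
  rcases h with ⟨u, a, b, a', b', ha, hb, -, -, -, -, hab, rfl⟩ | ⟨u, a, b, σ, ha, hb, -, -, rfl⟩
  · refine (coveredTerms_diff_union (Set.pair_subset ha hb) ?_).symm
    simp only [coveredTerms, Set.biUnion_pair, ← Set.prod_union, ← Finset.coe_union, hab]
  · refine (coveredTerms_diff_union (Set.pair_subset ha hb) ?_).symm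
    have hσ (p : Fin m × ℕ) : (∃ q : a, p = q ∨ p = σ q) ↔ p ∈ a ∨ p ∈ b := by
      rw [exists_or]
      refine or_congr ?_ ?_
      · exact ⟨by rintro ⟨q, rfl⟩; exact q.2, fun hp => ⟨⟨p, hp⟩, rfl⟩⟩
      · exact ⟨by rintro ⟨q, rfl⟩; exact (σ q).2, fun hp => ⟨σ.symm ⟨p, hp⟩, by simp⟩⟩
    ext ⟨w, p⟩
    simp only [coveredTerms, Set.biUnion_pair, Set.biUnion_range, Set.mem_union, Set.mem_prod,
      Set.mem_iUnion, Finset.mem_coe, Finset.mem_insert, Finset.mem_singleton, exists_and_left,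
      ← and_or_left, hσ]

theorem MutationEquivalent.coveredTerms_eq (h : MutationEquivalent D E E') :
    coveredTerms E = coveredTerms E' := by
  induction h with
  | rel _ _ h => exact h.2.2.coveredTerms_eq
  | refl _ => rfl
  | symm _ _ _ h => exact h.symm
  | trans _ _ _ _ _ h h' => exact h.trans h'

theorem MutationEquivalent.isFaceMultihypergraph_iff (h : MutationEquivalent D E E') :
    IsFaceMultihypergraph D E ↔ IsFaceMultihypergraph D E' := by
  induction h with
  | rel _ _ h => exact iff_of_true h.1 h.2.1
  | refl _ => rfl
  | symm _ _ _ h => exact h.symm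
  | trans _ _ _ _ _ h h' => exact h.trans h'

theorem IsFaceMultihypergraph.sum_label (hE : IsFaceMultihypergraph D E) {e : Label V m}
    (he : e ∈ E) : ∑ p ∈ e.2, D.part e.1 p.1 p.2 = 0 := by
  rcases hE.edge_or_hyperedge e he with ⟨p, q, hpq, h, hD⟩ | h
  · rw [h, Finset.sum_pair (ne_of_apply_ne Prod.fst hpq), hD, neg_add_cancel]
  · exact h.2.2.2

theorem IsFaceMultihypergraph.sum_face_eq_zero (hE : IsFaceMultihypergraph D E) {u : V}
    {S : Finset (Fin m)} (hS : ∀ e ∈ E, ∀ p ∈ e.2, ∀ q ∈ e.2, p.1 ∈ S → q.1 ∈ S)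
    (hu : ∀ i, ∀ k < D.mult u i, (u, (i, k)) ∈ coveredTerms E) :
    face R s u (∑ i ∈ S, x i) = 0 := by
  classical
  let T : Finset (Fin m × ℕ) := S.biUnion fun i => {i} ×ˢ Finset.range (D.mult u i)
  have mem_T (p : Fin m × ℕ) : p ∈ T ↔ p.1 ∈ S ∧ p.2 ∈ Finset.range (D.mult u p.1) := by
    simp only [T, Finset.mem_biUnion, Finset.mem_product, Finset.mem_singleton]
    grind
  let L : Finset (Finset (Fin m × ℕ)) := T.powerset.filter fun a => (u, a) ∈ E
  have hL {a : Finset (Fin m × ℕ)} (ha : a ∈ L) : (u, a) ∈ E := (Finset.mem_filter.1 ha).2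
  have hTL : T = L.biUnion id := by
    ext p
    refine ⟨fun hp => Finset.mem_biUnion.2 ?_, fun hp => ?_⟩
    swap
    · obtain ⟨a, ha, hpa⟩ := Finset.mem_biUnion.1 hp
      exact Finset.mem_powerset.1 (Finset.mem_filter.1 ha).1 hpa
    obtain ⟨a, ha, hpa⟩ := mem_coveredTerms.1 (hu p.1 p.2 (Finset.mem_range.1 ((mem_T p).1 hp).2))
    refine ⟨a, Finset.mem_filter.2 ⟨Finset.mem_powerset.2 fun q hq => (mem_T q).2 ⟨?_, ?_⟩, ha⟩,
      hpa⟩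
    · exact hS _ ha p hpa q hq ((mem_T p).1 hp).1
    · exact Finset.mem_range.2 (hE.index_lt _ ha q hq)
  calc face R s u (∑ i ∈ S, x i)
      = ∑ i ∈ S, ∑ k ∈ Finset.range (D.mult u i), D.part u i k := by
        rw [map_sum]; exact Finset.sum_congr rfl fun i _ => (D.sum_part u i).symm
    _ = ∑ p ∈ T, D.part u p.1 p.2 := (Finset.sum_finset_product' T _ _ mem_T).symm
    _ = ∑ a ∈ L, ∑ p ∈ a, D.part u p.1 p.2 := by
        rw [hTL]
        exact Finset.sum_biUnion fun a ha b hb hab => hE.label_disjoint _ (hL ha) _ (hL hb)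
          (fun h => hab (congrArg Prod.snd h)) rfl
    _ = 0 := Finset.sum_eq_zero fun a ha => hE.sum_label (hL ha)

end Mutation

section Matching

variable {ι α R : Type*} [CommRing R] [CharZero R]

theorem exists_matching [Finite ι] (ε : ι → SignType) (p : ι → α)
    (hsum : ∑ᶠ i, Finsupp.single (p i) (ε i : R) = 0) :
    ∃ σ : {i // ε i = 1} ≃ {i // ε i = -1}, ∀ i, p (σ i) = p i := by
  classical
  have := Fintype.ofFinite ι
  rw [finsum_eq_sum_of_fintype] at hsum
  have hcard (a : α) : Fintype.card {i // ε i = 1 ∧ p i = a} =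
      Fintype.card {i // ε i = -1 ∧ p i = a} := by
    have hcoeff (i : ι) : Finsupp.single (p i) (ε i : R) a =
        (if ε i = 1 ∧ p i = a then 1 else 0) - (if ε i = -1 ∧ p i = a then 1 else 0) := by
      rw [Finsupp.single_apply]
      cases ε i <;> simp [neg_ite]
    have h := DFunLike.congr_fun hsum a
    simp only [Finsupp.finsetSum_apply, Finsupp.zero_apply, hcoeff, Finset.sum_sub_distrib,
      Finset.sum_boole, sub_eq_zero, Nat.cast_inj] at h
    rwa [Fintype.card_subtype, Fintype.card_subtype]
  have e (a : α) : {i : {i // ε i = 1} // p i = a} ≃ {i : {i // ε i = -1} // p i = a} :=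
    ((Equiv.subtypeSubtypeEquivSubtypeInter (ε · = 1) (p · = a)).trans
      (Fintype.equivOfCardEq (hcard a))).trans
      (Equiv.subtypeSubtypeEquivSubtypeInter (ε · = -1) (p · = a)).symm
  exact ⟨Equiv.ofFiberEquiv e, fun i => Equiv.ofFiberEquiv_map e i⟩

end Matching

section Irreducible

variable {V R : Type*} [CommRing R] {G : Digraph V} {s : Side} {n : ℤ} {v : V} {m : ℕ}

theorem endSet_extend {z : Chains V R} (hz : extend G R s v z ≠ 0) :
    endSet s (extend G R s v z) = {v} := by
  have hsupp : extend G R s v z ∈ Finsupp.supported R R {l | s.endpoint l = some v} := by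
    refine map_mem_of_mem_supported (S := Set.univ) (fun l _ => ?_) (Set.subset_univ _)
    rw [extend_single]
    split_ifs
    · refine Finsupp.single_mem_supported R _ ?_
      cases s <;> simp [Side.endpoint, Side.add]
    · exact zero_mem _
  refine Set.eq_singleton_iff_nonempty_unique_mem.2 ⟨?_, ?_⟩
  · obtain ⟨l, hl⟩ := Finsupp.support_nonempty_iff.2 hz
    exact ⟨v, l, hl, hsupp hl⟩
  · rintro w ⟨l, hl, hw⟩
    exact Option.some_injective _ (hw.symm.trans (hsupp hl))

/-- `x` is zero, or up to sign an elementary path in `E`. -/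
def IsSignedPath (E : Set (Chains V R)) (x : Chains V R) : Prop :=
  ∃ (ε : SignType) (l : List V), x = Finsupp.single l (ε : R) ∧ (ε ≠ 0 → path R l ∈ E)

theorem IsSignedPath.zero (E : Set (Chains V R)) : IsSignedPath E 0 :=
  ⟨0, [], by simp, fun h => absurd rfl h⟩

theorem isSignedPath_path {E : Set (Chains V R)} {l : List V} (hl : path R l ∈ E) :
    IsSignedPath E (path R l) :=
  ⟨1, l, by simp [path], fun _ => hl⟩

theorem IsSignedPath.neg {E : Set (Chains V R)} {x : Chains V R} (hx : IsSignedPath E x) :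
    IsSignedPath E (-x) := by
  obtain ⟨ε, l, rfl, hl⟩ := hx
  exact ⟨-ε, l, by rw [← Finsupp.single_neg]; cases ε <;> simp,
    fun h => hl fun h0 => h (by rw [h0]; rfl)⟩

theorem IsSignedPath.mem_or_neg_mem {E : Set (Chains V R)} {x : Chains V R}
    (hx : IsSignedPath E x) (h0 : x ≠ 0) : x ∈ E ∨ -x ∈ E := by
  obtain ⟨ε, l, rfl, hl⟩ := hx
  cases ε with
  | zero => exact absurd (by simp) h0
  | pos => exact .inl (by simpa [path] using hl (by decide))
  | neg => exact .inr (by simpa [path, ← Finsupp.single_neg] using hl (by decide))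

theorem IsSignedPath.mem {E : Set (Chains V R)} {M : Submodule R (Chains V R)} (hE : E ⊆ M)
    {x : Chains V R} (hx : IsSignedPath E x) : x ∈ M := by
  by_cases h0 : x = 0
  · rw [h0]
    exact M.zero_mem
  · exact (hx.mem_or_neg_mem h0).elim (@hE _) fun h => M.neg_mem_iff.1 (hE h)

/-- A family whose members lie in `E₁` up to sign, have signed elementary paths in `E₂` as
faces, can be extended by `v`, and do not cancel in pairs. Its faces need no further
decomposition, so the only choice in a face multihypergraph on it is that of the labels. -/
structure IsSimpleFamily {ι : Type*} (G : Digraph V) (s : Side) (v : V)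
    (E₁ E₂ : Set (Chains V R)) (x : ι → Chains V R) : Prop where
  ne_neg : ∀ i j, i ≠ j → x i ≠ -x j
  mem_or_neg_mem : ∀ i, x i ∈ E₁ ∨ -x i ∈ E₁
  isSignedPath_face : ∀ i u, IsSignedPath E₂ (face R s u (x i))
  mem_joined : ∀ i, x i ∈ joined G R s v

theorem IsSimpleFamily.comp {ι κ : Type*} {E₁ E₂ : Set (Chains V R)} {x : ι → Chains V R}
    (hx : IsSimpleFamily G s v E₁ E₂ x) {f : κ → ι} (hf : Function.Injective f) :
    IsSimpleFamily G s v E₁ E₂ (x ∘ f) where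
  ne_neg _ _ hij := hx.ne_neg _ _ (hf.ne hij)
  mem_or_neg_mem _ := hx.mem_or_neg_mem _
  isSignedPath_face _ := hx.isSignedPath_face _
  mem_joined _ := hx.mem_joined _

theorem IsSimpleFamily.mem_submodule {ι : Type*} {E₁ E₂ : Set (Chains V R)}
    {x : ι → Chains V R} (hx : IsSimpleFamily G s v E₁ E₂ x) {M : Submodule R (Chains V R)}
    (hE₁ : E₁ ⊆ M) (i : ι) : x i ∈ M :=
  (hx.mem_or_neg_mem i).elim (@hE₁ _) fun h => M.neg_mem_iff.1 (hE₁ h)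

open scoped Classical in
/-- The decomposition of every face of a family into at most one term. -/
noncomputable def trivialDecomposition {x : Fin m → Chains V R}
    (hΩ : ∀ i, x i ∈ Omega G R n) (hneg : ∀ i j, i ≠ j → x i ≠ -x j)
    (hface : ∀ i u, face R s u (x i) ∈ Omega G R (n - 1)) : FaceDecomposition G R s n x where
  vertex_mem := hΩ
  vertex_ne_neg := hneg
  mult u i := if face R s u (x i) = 0 then 0 else 1
  part u i _ := face R s u (x i)
  part_mem u i _ _ := hface i u
  sum_part u i := by
    split_ifs with h
    · rw [h, Finset.sum_range_zero]
    · rw [Finset.sum_range_one]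
  sum_ne_zero u i T hT hT' := by
    split_ifs at hT with h
    · rw [Finset.range_zero, Finset.subset_empty] at hT
      exact absurd hT hT'.ne_empty
    · rw [Finset.range_one, hT'.subset_singleton_iff] at hT
      rwa [hT, Finset.sum_singleton]

theorem lt_mult_trivialDecomposition_iff {x : Fin m → Chains V R}
    {hΩ : ∀ i, x i ∈ Omega G R n} {hneg : ∀ i j, i ≠ j → x i ≠ -x j}
    {hface : ∀ i u, face R s u (x i) ∈ Omega G R (n - 1)} {u : V} {i : Fin m} {k : ℕ} :
    k < (trivialDecomposition hΩ hneg hface).mult u i ↔ k = 0 ∧ face R s u (x i) ≠ 0 := by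
  simp only [trivialDecomposition]
  split_ifs with h <;> simp [h]

/-- The hyperedges that pair, for every `u` with `P u`, the faces of sign `1` at `u` with those
of sign `-1`, where `ε u i` is the sign of the face at `u` of the `i`-th vertex. -/
def matchingLabels {P : V → Prop} {ε : V → Fin m → SignType}
    (σ : ∀ u, P u → ({i // ε u i = 1} ≃ {i // ε u i = -1})) : Set (Label V m) :=
  {e | ∃ u, ∃ hu : P u, ∃ i : {i // ε u i = 1},
    e = (u, {((i : Fin m), 0), ((σ u hu i : Fin m), 0)})}

theorem mem_coveredTerms_matchingLabels {P : V → Prop} {ε : V → Fin m → SignType}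
    (σ : ∀ u, P u → ({i // ε u i = 1} ≃ {i // ε u i = -1})) {u : V} (hu : P u) {i : Fin m}
    (hi : ε u i ≠ 0) : (u, (i, 0)) ∈ coveredTerms (matchingLabels σ) := by
  obtain h | h : ε u i = -1 ∨ ε u i = 1 := by
    cases h : ε u i <;> simp_all
  · exact mem_coveredTerms.2 ⟨_, ⟨u, hu, (σ u hu).symm ⟨i, h⟩, rfl⟩, by simp⟩
  · exact mem_coveredTerms.2 ⟨_, ⟨u, hu, ⟨i, h⟩, rfl⟩, by simp⟩

theorem isFaceMultihypergraph_matchingLabels {x : Fin m → Chains V R}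
    {D : FaceDecomposition G R s n x} {P : V → Prop} {ε : V → Fin m → SignType}
    {σ : ∀ u, P u → ({i // ε u i = 1} ≃ {i // ε u i = -1})}
    (hmult : ∀ u i, ε u i ≠ 0 → 0 < D.mult u i)
    (hpart : ∀ u hu i, D.part u (σ u hu i) 0 = -D.part u i 0) :
    IsFaceMultihypergraph D (matchingLabels σ) := by
  have hne (u : V) (i : {i // ε u i = 1}) (j : {i // ε u i = -1}) : (i : Fin m) ≠ j := by
    intro h
    have := i.2.symm.trans (h ▸ j.2)
    exact absurd this (by decide)
  refine ⟨?_, ?_, ?_⟩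
  · rintro _ ⟨u, hu, i, rfl⟩ p hp
    rcases Finset.mem_insert.1 hp with rfl | hp
    · exact hmult u i (i.2.trans_ne (by decide))
    · rw [Finset.mem_singleton.1 hp]
      exact hmult u _ ((σ u hu i).2.trans_ne (by decide))
  · rintro _ ⟨u, hu, i, rfl⟩
    exact .inl ⟨_, _, hne u i _, rfl, by rw [hpart, neg_neg]⟩
  · rintro _ ⟨u, hu, i, rfl⟩ _ ⟨w, hw, j, rfl⟩ hij (rfl : u = w)
    have hij' : i ≠ j := fun h => hij (by rw [h])
    have hσ : σ u hu i ≠ σ u hu j := (σ u hu).injective.ne hij'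
    simp [Subtype.coe_ne_coe.2 hij'.symm, Subtype.coe_ne_coe.2 hσ.symm, hne, (hne u _ _).symm]

theorem isStronglyConnected_of_irreducible {x : Fin m → Chains V R}
    {D : FaceDecomposition G R s n x} {E : Set (Label V m)} (hE : IsFaceMultihypergraph D E)
    (hcover : ∀ u, IsBlocked G s v u → ∀ i, ∀ k < D.mult u i, (u, (i, k)) ∈ coveredTerms E)
    (hirr : ∀ S : Finset (Fin m), S.Nonempty → ∑ i ∈ S, x i ∈ unblocked G R s v →
      S = Finset.univ) : IsStronglyConnected D E := by
  classical
  intro E' hEE' i j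
  have hE' := hEE'.isFaceMultihypergraph_iff.1 hE
  let r (i j : Fin m) : Prop := ∃ e ∈ E', ∃ p ∈ e.2, ∃ q ∈ e.2, p.1 = i ∧ q.1 = j
  let component : Finset (Fin m) := Finset.univ.filter (Relation.ReflTransGen r i)
  have hi : i ∈ component := Finset.mem_filter.2 ⟨Finset.mem_univ i, .refl⟩
  have hcomponent : component = Finset.univ := by
    refine hirr component ⟨i, hi⟩ (mem_unblocked_iff.2 fun u hu => ?_)
    refine hE'.sum_face_eq_zero (fun e he p hp q hq hpi => ?_) fun i k hk => ?_
    · exact Finset.mem_filter.2 ⟨Finset.mem_univ _,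
        (Finset.mem_filter.1 hpi).2.tail ⟨e, he, p, hp, q, hq, rfl, rfl⟩⟩
    · rw [← hEE'.coveredTerms_eq]
      exact hcover u hu i k hk
  exact (Finset.mem_filter.1 (hcomponent ▸ Finset.mem_univ j)).2

theorem IsSimpleFamily.exists_isFaceMultihypergraph [CharZero R] {E₁ E₂ : Set (Chains V R)}
    {x : Fin m → Chains V R} (hx : IsSimpleFamily G s v E₁ E₂ x)
    (hΩ : ∀ i, x i ∈ Omega G R n) (hface : ∀ i u, face R s u (x i) ∈ Omega G R (n - 1))
    (hsum : ∑ i, x i ∈ unblocked G R s v) :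
    ∃ E, IsFaceMultihypergraph (trivialDecomposition hΩ hx.ne_neg hface) E ∧
      IsProper G s E v ∧
      ∀ u, IsBlocked G s v u → ∀ i, ∀ k < (trivialDecomposition hΩ hx.ne_neg hface).mult u i,
        (u, (i, k)) ∈ coveredTerms E := by
  choose ε l hεl _ using fun u i => hx.isSignedPath_face i u
  have hmatching (u : V) (hu : IsBlocked G s v u) := exists_matching (R := R) (ε u) (l u) (by
    simp only [finsum_eq_sum_of_fintype, ← hεl, ← map_sum]
    exact mem_unblocked_iff.1 hsum u hu)
  choose σ hσ using hmatching
  have hε (u : V) (i : Fin m) : face R s u (x i) ≠ 0 ↔ ε u i ≠ 0 := by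
    rw [hεl, ne_eq, Finsupp.single_eq_zero]
    cases ε u i <;> simp
  refine ⟨matchingLabels σ, isFaceMultihypergraph_matchingLabels (fun u i hi => ?_)
    fun u hu i => ?_, ?_, fun u hu i k hk => ?_⟩
  · exact lt_mult_trivialDecomposition_iff.2 ⟨rfl, (hε u i).2 hi⟩
  · change face R s u (x _) = -face R s u (x _)
    rw [hεl, hεl, hσ, i.2, (σ u hu i).2, ← Finsupp.single_neg]
    simp
  · rintro _ ⟨u, hu, i, rfl⟩
    exact hu.symm
  · obtain ⟨rfl, hi⟩ := lt_mult_trivialDecomposition_iff.1 hk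
    exact mem_coveredTerms_matchingLabels σ hu ((hε u i).1 hi)

theorem IsSimpleFamily.isInductive_extend_sum [CharZero R] {E₁ E₂ : Set (Chains V R)}
    {x : Fin m → Chains V R} (hx : IsSimpleFamily G s v E₁ E₂ x)
    (hE₁ : E₁ ⊆ Omega G R (n - 1)) (hE₂ : E₂ ⊆ Omega G R (n - 1 - 1))
    (hsum : ∑ i, x i ∈ unblocked G R s v)
    (hirr : ∀ S : Finset (Fin m), S.Nonempty → ∑ i ∈ S, x i ∈ unblocked G R s v →
      S = Finset.univ) (h0 : extend G R s v (∑ i, x i) ≠ 0) :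
    IsInductive G R s n E₁ E₂ (extend G R s v (∑ i, x i)) := by
  have hΩ := hx.mem_submodule hE₁
  obtain ⟨E, hE, hproper, hcover⟩ := hx.exists_isFaceMultihypergraph hΩ
    (fun i u => (hx.isSignedPath_face i u).mem hE₂) hsum
  refine ⟨?_, v, endSet_extend h0, m, x, _, E, hE,
    isStronglyConnected_of_irreducible hE hcover hirr, fun i => mem_joined_iff.1 (hx.mem_joined i),
    ⟨hproper, fun i u _ huv hu k hk => ?_⟩, rfl, hx.mem_or_neg_mem, fun u i k hk => ?_⟩
  · have h := extend_mem_Omega (sum_mem fun i _ => hΩ i) (sum_mem fun i _ => hx.mem_joined i) hsum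
    rwa [sub_add_cancel] at h
  · obtain ⟨a, ha, hka⟩ := mem_coveredTerms.1 (hcover u ⟨huv, hu⟩ i k hk)
    exact ⟨_, ha, rfl, hka⟩
  · exact (hx.isSignedPath_face i u).mem_or_neg_mem (lt_mult_trivialDecomposition_iff.1 hk).2

theorem IsSimpleFamily.isInductive_extend_sum_finset [CharZero R] {ι : Type*}
    {E₁ E₂ : Set (Chains V R)} {x : ι → Chains V R} (hx : IsSimpleFamily G s v E₁ E₂ x)
    (hE₁ : E₁ ⊆ Omega G R (n - 1)) (hE₂ : E₂ ⊆ Omega G R (n - 1 - 1)) {A : Finset ι}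
    (hsum : ∑ i ∈ A, x i ∈ unblocked G R s v)
    (hirr : ∀ S ⊆ A, S.Nonempty → ∑ i ∈ S, x i ∈ unblocked G R s v → S = A)
    (h0 : extend G R s v (∑ i ∈ A, x i) ≠ 0) :
    IsInductive G R s n E₁ E₂ (extend G R s v (∑ i ∈ A, x i)) := by
  let e : Fin A.card ↪ ι := A.equivFin.symm.toEmbedding.trans (.subtype (· ∈ A))
  have hA : Finset.univ.map e = A := by
    rw [← Finset.map_map, Finset.map_univ_equiv]
    exact A.attach_map_val
  have hsum_map (S : Finset (Fin A.card)) : ∑ k ∈ S, (x ∘ e) k = ∑ i ∈ S.map e, x i :=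
    (Finset.sum_map S e x).symm
  rw [← hA, ← hsum_map] at hsum h0 ⊢
  refine (hx.comp e.injective).isInductive_extend_sum hE₁ hE₂ hsum (fun S hS hSsum => ?_) h0
  rw [hsum_map] at hSsum
  rw [← Finset.map_inj (f := e), hA]
  exact hirr _ (hA.subset.trans' (Finset.map_subset_map.2 S.subset_univ)) (hS.map) hSsum

theorem IsSimpleFamily.extend_sum_mem_span [CharZero R] {ι : Type*} {E₁ E₂ : Set (Chains V R)}
    {x : ι → Chains V R} (hx : IsSimpleFamily G s v E₁ E₂ x)
    (hE₁ : E₁ ⊆ Omega G R (n - 1)) (hE₂ : E₂ ⊆ Omega G R (n - 1 - 1)) (A : Finset ι)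
    (hsum : ∑ i ∈ A, x i ∈ unblocked G R s v) :
    extend G R s v (∑ i ∈ A, x i) ∈ Submodule.span R {y | IsInductive G R s n E₁ E₂ y} := by
  classical
  induction A using Finset.strongInduction with
  | H A ih =>
    by_cases hirr : ∀ S ⊆ A, S.Nonempty → ∑ i ∈ S, x i ∈ unblocked G R s v → S = A
    · by_cases h0 : extend G R s v (∑ i ∈ A, x i) = 0
      · rw [h0]
        exact zero_mem _
      · exact Submodule.subset_span (hx.isInductive_extend_sum_finset hE₁ hE₂ hsum hirr h0)
    · push Not at hirr
      obtain ⟨S, hSA, hS, hSsum, hne⟩ := hirr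
      rw [← Finset.sum_sdiff hSA] at hsum ⊢
      rw [map_add]
      exact add_mem (ih _ (Finset.sdiff_ssubset hSA hS) ((add_mem_cancel_right hSsum).1 hsum))
        (ih _ (hSA.ssubset_of_ne hne) hSsum)

end Irreducible

section LowDimensions

variable {V R : Type*} [CommRing R] {G : Digraph V} {n : ℤ} {v : V} {l : List V}

theorem mem_allowedLists_zero : l ∈ allowedLists G 0 ↔ ∃ a, l = [a] := by
  refine ⟨fun ⟨_, hlen, _⟩ => List.length_eq_one_iff.1 (by omega), ?_⟩
  rintro ⟨a, rfl⟩
  simp [allowedLists]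

theorem mem_allowedLists_one : l ∈ allowedLists G 1 ↔ ∃ a b, l = [a, b] ∧ G.Adj a b := by
  constructor
  · rintro ⟨-, hlen, hc⟩
    obtain ⟨a, b, rfl⟩ := List.length_eq_two.1 (by omega : l.length = 2)
    exact ⟨a, b, rfl, by simpa using hc⟩
  · rintro ⟨a, b, rfl, hab⟩
    simpa [allowedLists] using hab

theorem mem_allowedLists_two :
    l ∈ allowedLists G 2 ↔ ∃ a b c, l = [a, b, c] ∧ G.Adj a b ∧ G.Adj b c := by
  constructor
  · rintro ⟨-, hlen, hc⟩
    obtain ⟨a, b, c, rfl⟩ := List.length_eq_three.1 (by omega : l.length = 3)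
    exact ⟨a, b, c, rfl, by simpa using hc⟩
  · rintro ⟨a, b, c, rfl, h⟩
    simpa [allowedLists] using h

theorem isBasisOf_path_image (S : Set (List V)) :
    IsBasisOf (path R '' S) (Finsupp.supported R R S) :=
  ⟨((Finsupp.linearIndependent_single_one R (List V)).linearIndepOn S).id_image,
    (Finsupp.supported_eq_span_single R S).symm⟩

theorem inductiveElements_subset_Omega (G : Digraph V) (R : Type*) [CommRing R] (s : Side)
    (i : ℕ) : inductiveElements G R s i ⊆ Omega G R i := by
  match i with
  | 0 =>
    have hpath (v : V) : path R [v] ∈ Omega G R (0 : ℕ) := by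
      rw [Omega_eq_allowed (by simp)]
      exact Finsupp.single_mem_supported R 1 (mem_allowedLists_zero.2 ⟨v, rfl⟩)
    rintro _ ⟨v, rfl | rfl⟩
    · exact hpath v
    · exact neg_mem (hpath v)
  | 1 => exact fun _ h => h.1
  | n + 2 => exact fun _ h => h.1

theorem path_mem_joined_upper (hv : ∀ w ∈ l.getLast?, G.Adj w v) :
    path R l ∈ joined G R .upper v :=
  Finsupp.single_mem_supported R 1 hv

theorem isSignedPath_face_upper_path {E : Set (Chains V R)}
    (hl : l.dropLast ≠ [] → path R l.dropLast ∈ E) (u : V) :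
    IsSignedPath E (face R .upper u (path R l)) := by
  rw [path, face_single]
  split_ifs with h
  · refine isSignedPath_path (hl fun h0 => ?_)
    simp [Side.truncate, Side.endpoint, h0] at h
  · exact .zero E

theorem face_upper_path_triple (u a b c : V) [Decidable (b = u)] :
    face R .upper u (path R [a, b, c]) = if b = u then path R [a, b] else 0 := by
  simp [path, face_single, Side.endpoint, Side.truncate]

theorem extend_upper_path (h : (l ++ [v]).IsChain G.Adj) :
    extend G R .upper v (path R l) = path R (l ++ [v]) := by
  rw [path, extend_single, Side.add, if_pos h]
  rfl

theorem path_ne_zero [Nontrivial R] (l : List V) : path R l ≠ 0 :=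
  Finsupp.single_ne_zero.2 one_ne_zero

variable [CharZero R] {E₁ E₂ : Set (Chains V R)}

theorem isInductive_path_concat (hE₁ : E₁ ⊆ Omega G R (n - 1)) (hE₂ : E₂ ⊆ Omega G R (n - 1 - 1))
    (hl : path R l ∈ E₁) (hl' : l.dropLast ≠ [] → path R l.dropLast ∈ E₂)
    (hu : ∀ u ∈ l.dropLast.getLast?, ¬ IsBlocked G .upper v u)
    (h : (l ++ [v]).IsChain G.Adj) : IsInductive G R .upper n E₁ E₂ (path R (l ++ [v])) := by
  have hsimple : IsSimpleFamily G .upper v E₁ E₂ fun _ : Fin 1 => path R l := {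
    ne_neg i j hij := absurd (Subsingleton.elim i j) hij
    mem_or_neg_mem _ := .inl hl
    isSignedPath_face _ := isSignedPath_face_upper_path hl'
    mem_joined _ := path_mem_joined_upper fun w hw => (List.isChain_append.1 h).2.2 w hw v rfl }
  have hunblocked : path R l ∈ unblocked G R .upper v := mem_unblocked_iff.2 fun u hub => by
    rw [path, face_single]
    exact if_neg fun hlu => hu u hlu hub
  have key := hsimple.isInductive_extend_sum hE₁ hE₂ (by simpa using hunblocked)
    (fun S hS _ => hS.eq_univ)
  rw [Fin.sum_univ_one, extend_upper_path h] at key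
  exact key (path_ne_zero _)

theorem isInductive_path_sub_path {l' : List V} (hE₁ : E₁ ⊆ Omega G R (n - 1))
    (hE₂ : E₂ ⊆ Omega G R (n - 1 - 1)) (hne : l ≠ l') (hdrop : l.dropLast = l'.dropLast)
    (hl : path R l ∈ E₁) (hl' : path R l' ∈ E₁) (hE : path R l.dropLast ∈ E₂) {u : V}
    (hu : l.dropLast.getLast? = some u) (hub : IsBlocked G .upper v u)
    (h : (l ++ [v]).IsChain G.Adj) (h' : (l' ++ [v]).IsChain G.Adj) :
    IsInductive G R .upper n E₁ E₂ (path R (l ++ [v]) - path R (l' ++ [v])) := by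
  have hface (w : V) : face R .upper w (path R l) = face R .upper w (path R l') := by
    rw [path, path, face_single, face_single, Side.truncate, Side.truncate, hdrop]
  have hface_ne : face R .upper u (path R l) ≠ 0 := by
    rw [path, face_single, Side.truncate, Side.endpoint, if_pos hu]
    exact path_ne_zero _
  have hsimple : IsSimpleFamily G .upper v E₁ E₂ ![path R l, -path R l'] := {
    ne_neg i j hij := by
      have := (Finsupp.single_left_injective (one_ne_zero (α := R))).ne hne
      fin_cases i <;> fin_cases j <;> simp_all [path, eq_comm]
    mem_or_neg_mem := Fin.forall_fin_two.2 ⟨.inl hl, .inr (by simpa using hl')⟩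
    isSignedPath_face := Fin.forall_fin_two.2
      ⟨isSignedPath_face_upper_path fun _ => hE, fun w => by
        simpa [← hface] using (isSignedPath_face_upper_path (fun _ => hE) w).neg⟩
    mem_joined := Fin.forall_fin_two.2
      ⟨path_mem_joined_upper fun w hw => (List.isChain_append.1 h).2.2 w hw v rfl,
        neg_mem (path_mem_joined_upper fun w hw => (List.isChain_append.1 h').2.2 w hw v rfl)⟩ }
  have hirr (S : Finset (Fin 2)) (hS : S.Nonempty)
      (hSsum : ∑ i ∈ S, ![path R l, -path R l'] i ∈ unblocked G R .upper v) :
      S = Finset.univ := by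
    have hSu := mem_unblocked_iff.1 hSsum u hub
    fin_cases S <;> first | rfl | simp_all
  have key := hsimple.isInductive_extend_sum hE₁ hE₂
    (mem_unblocked_iff.2 fun w _ => by simp [hface]) hirr
  simp only [Fin.sum_univ_two, Matrix.cons_val_zero, Matrix.cons_val_one, ← sub_eq_add_neg,
    map_sub, extend_upper_path h, extend_upper_path h'] at key
  refine key (sub_ne_zero.2 ?_)
  exact (Finsupp.single_left_injective one_ne_zero).ne ((List.append_left_injective [v]).ne hne)

theorem path_pair_mem_inductiveElements {a b : V} (hab : G.Adj a b) :
    path R [a, b] ∈ inductiveElements G R .upper 1 :=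
  isInductive_path_concat (l := [a]) (n := 1) (inductiveElements_subset_Omega G R .upper 0)
    (Set.empty_subset _) ⟨a, .inl rfl⟩ (by simp) (by simp) (by simpa using hab)

end LowDimensions

section Cells

variable {V : Type*} {G : Digraph V} {β : V → V → V}

/-- `β` chooses, for any `a` and `c` that are the ends of a path `a, b, c` of `G`, the middle
vertex of such a path. -/
def IsMiddleChoice (G : Digraph V) (β : V → V → V) : Prop :=
  ∀ a b c, G.Adj a b → G.Adj b c → G.Adj a (β a c) ∧ G.Adj (β a c) c

open scoped Classical in
/-- Inserts the middle vertex `β a c` into every pair `a, c` that is neither an edge nor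
constant, and drops all other lists. -/
noncomputable def insertMiddle (G : Digraph V) (R : Type*) [CommRing R] (β : V → V → V) :
    Chains V R →ₗ[R] Chains V R :=
  Finsupp.linearCombination R fun
    | [a, c] => if IsBlocked G .upper c a then path R [a, β a c, c] else 0
    | _ => 0

/-- The cell of a path `a, b, c` of `G`: the path itself if `a` and `c` are equal or joined by
an edge, and otherwise its difference with the path through the chosen middle vertex `β a c`.
The correction is written as `insertMiddle` of the boundary, which vanishes on `Ω_2`. -/
noncomputable def cell (G : Digraph V) (R : Type*) [CommRing R] (β : V → V → V) (l : List V) :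
    Chains V R :=
  path R l + insertMiddle G R β (boundary V R (path R l))

/-- The `2`-paths of `G` whose cell does not vanish. -/
def cellPaths (G : Digraph V) (β : V → V → V) : Set (List V) :=
  {l ∈ allowedLists G 2 | ∀ a c, IsBlocked G .upper c a → l ≠ [a, β a c, c]}

theorem exists_isMiddleChoice (G : Digraph V) : ∃ β, IsMiddleChoice G β := by
  have hmiddle (a c : V) : ∃ m, ∀ b, G.Adj a b → G.Adj b c → G.Adj a m ∧ G.Adj m c := by
    by_cases h : ∃ b, G.Adj a b ∧ G.Adj b c
    · exact h.imp fun b hb _ _ _ => hb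
    · exact ⟨a, fun b hab hbc => absurd ⟨b, hab, hbc⟩ h⟩
  choose β hβ using hmiddle
  exact ⟨β, fun a b c => hβ a c b⟩

variable {R : Type*} [CommRing R]

open scoped Classical in
theorem insertMiddle_path_pair (a c : V) : insertMiddle G R β (path R [a, c]) =
    if IsBlocked G .upper c a then path R [a, β a c, c] else 0 := by
  simp [insertMiddle, path]

theorem insertMiddle_path_of_adj {a c : V} (h : G.Adj a c) :
    insertMiddle G R β (path R [a, c]) = 0 := by
  rw [insertMiddle_path_pair, if_neg fun hb => hb.2 h]

theorem insertMiddle_apply_eq_zero {l : List V} (hl : l ∈ cellPaths G β) (y : Chains V R) :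
    insertMiddle G R β y l = 0 := by
  suffices insertMiddle G R β y ∈ Finsupp.supported R R {l}ᶜ from
    (Finsupp.mem_supported' _ _).1 this l (by simp)
  refine map_mem_of_mem_supported (S := Set.univ) (fun k _ => ?_) (Set.subset_univ _)
  rw [insertMiddle, Finsupp.linearCombination_single, one_smul]
  split
  · split_ifs with hb
    · exact Finsupp.single_mem_supported R 1 (hl.2 _ _ hb).symm
    · exact zero_mem _
  · exact zero_mem _

theorem insertMiddle_boundary_eq_zero {x : Chains V R} (hx : x ∈ Omega G R 2) :
    insertMiddle G R β (boundary V R x) = 0 := by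
  rw [← Submodule.mem_bot R]
  refine map_mem_of_mem_supported (S := allowedLists G 1 ∪ irregularLists V 1) (fun l hl => ?_)
    (mem_Omega_iff.1 hx).2
  rw [Submodule.mem_bot]
  obtain hl | ⟨hlen, hl⟩ := hl
  · obtain ⟨a, c, rfl, hac⟩ := mem_allowedLists_one.1 hl
    exact insertMiddle_path_of_adj hac
  · obtain ⟨a, c, rfl⟩ := List.length_eq_two.1 (by omega : l.length = 2)
    exact (insertMiddle_path_pair a c).trans (if_neg fun hb => hl (by simpa using hb.1))

open scoped Classical in
theorem cell_triple {a b c : V} (hab : G.Adj a b) (hbc : G.Adj b c) : cell G R β [a, b, c] =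
    path R [a, b, c] - if IsBlocked G .upper c a then path R [a, β a c, c] else 0 := by
  have hboundary : boundary V R (path R [a, b, c]) =
      path R [b, c] - path R [a, c] + path R [a, b] := by
    simp [path, boundary_single, Finset.sum_range_succ, sub_eq_add_neg]
  rw [cell, hboundary, map_add, map_sub, insertMiddle_path_of_adj hab,
    insertMiddle_path_of_adj hbc, insertMiddle_path_pair, zero_sub, add_zero, sub_eq_add_neg]

theorem cell_apply {l : List V} (hl : l ∈ cellPaths G β) (l' : List V) :
    cell G R β l' l = path R l' l := by
  rw [cell, Finsupp.add_apply, insertMiddle_apply_eq_zero hl, add_zero]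

theorem cell_eq_zero {l : List V} (hl : l ∈ allowedLists G 2) (hl' : l ∉ cellPaths G β) :
    cell G R β l = 0 := by
  obtain ⟨a, c, hb, rfl⟩ : ∃ a c, IsBlocked G .upper c a ∧ l = [a, β a c, c] := by
    by_contra! h
    exact hl' ⟨hl, h⟩
  have hadj : G.Adj a (β a c) ∧ G.Adj (β a c) c := by simpa [allowedLists] using hl
  rw [cell_triple hadj.1 hadj.2, if_pos hb, sub_self]

theorem linearIndepOn_cell (β : V → V → V) : LinearIndepOn R (cell G R β) (cellPaths G β) := by
  classical
  refine linearIndependent_iff'.2 fun S g hg i hi => ?_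
  have hi0 := DFunLike.congr_fun hg (i : List V)
  simpa [Finsupp.finsetSum_apply, cell_apply i.2, path, Finsupp.single_apply,
    ← Subtype.ext_iff, hi] using hi0

open scoped Classical in
theorem eq_sum_smul_cell {x : Chains V R} (hx : x ∈ Omega G R 2) (β : V → V → V) :
    x = ∑ l ∈ x.support with l ∈ cellPaths G β, x l • cell G R β l := by
  let cellMap := LinearMap.id + insertMiddle G R β ∘ₗ boundary V R
  calc
    x = cellMap x := by
      rw [LinearMap.add_apply, LinearMap.comp_apply, insertMiddle_boundary_eq_zero hx, add_zero,
        LinearMap.id_apply]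
    _ = ∑ l ∈ x.support, x l • cell G R β l := by
      conv_lhs => rw [← Finsupp.sum_single x, Finsupp.sum, map_sum]
      refine Finset.sum_congr rfl fun l _ => ?_
      rw [← Finsupp.smul_single_one, map_smul]
      rfl
    _ = _ := (Finset.sum_filter_of_ne fun l hl h => by
      by_contra hl'
      exact h (by rw [cell_eq_zero (hx.1 hl) hl', smul_zero])).symm

theorem cell_mem_inductiveElements [CharZero R] (hβ : IsMiddleChoice G β) {l : List V}
    (hl : l ∈ cellPaths G β) : cell G R β l ∈ inductiveElements G R .upper 2 := by
  obtain ⟨a, b, c, rfl, hab, hbc⟩ := mem_allowedLists_two.1 hl.1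
  obtain ⟨haβ, hβc⟩ := hβ a b c hab hbc
  have hE₁ := inductiveElements_subset_Omega G R .upper 1
  have hE₂ := inductiveElements_subset_Omega G R .upper 0
  rw [cell_triple hab hbc]
  split_ifs with hb
  · have hbβ : b ≠ β a c := fun h => hl.2 a c hb (by rw [← h])
    exact isInductive_path_sub_path (n := 2) (l := [a, b]) (l' := [a, β a c]) hE₁ hE₂
      (by simpa using hbβ) rfl (path_pair_mem_inductiveElements hab)
      (path_pair_mem_inductiveElements haβ) ⟨a, .inl rfl⟩ rfl hb (by simp [hab, hbc])
      (by simp [haβ, hβc])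
  · rw [sub_zero]
    exact isInductive_path_concat (n := 2) (l := [a, b]) hE₁ hE₂
      (path_pair_mem_inductiveElements hab) (fun _ => ⟨a, .inl rfl⟩) (by simpa using hb)
      (by simp [hab, hbc])

theorem isBasisOf_cell_image [CharZero R] (hβ : IsMiddleChoice G β) :
    IsBasisOf (cell G R β '' cellPaths G β) (Omega G R 2) := by
  classical
  refine ⟨(linearIndepOn_cell β).id_image, le_antisymm (Submodule.span_le.2 ?_) fun x hx => ?_⟩
  · rintro _ ⟨l, hl, rfl⟩
    exact inductiveElements_subset_Omega G R .upper 2 (cell_mem_inductiveElements hβ hl)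
  · rw [eq_sum_smul_cell hx β]
    exact Submodule.sum_mem _ fun l hl => Submodule.smul_mem _ _
      (Submodule.subset_span ⟨l, (Finset.mem_filter.1 hl).2, rfl⟩)

theorem exists_isBasisOf_Omega_upper (G : Digraph V) (R : Type*) [CommRing R] [CharZero R]
    {i : ℕ} (hi : i ≤ 2) :
    ∃ B ⊆ inductiveElements G R .upper i, IsBasisOf B (Omega G R i) := by
  match i with
  | 0 =>
    refine ⟨path R '' allowedLists G 0, Set.image_subset_iff.2 fun l hl => ?_, ?_⟩
    · obtain ⟨a, rfl⟩ := mem_allowedLists_zero.1 hl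
      exact ⟨a, .inl rfl⟩
    · rw [Omega_eq_allowed (by simp)]
      exact isBasisOf_path_image _
  | 1 =>
    refine ⟨path R '' allowedLists G 1, Set.image_subset_iff.2 fun l hl => ?_, ?_⟩
    · obtain ⟨a, b, rfl, hab⟩ := mem_allowedLists_one.1 hl
      exact path_pair_mem_inductiveElements hab
    · rw [Omega_eq_allowed (by simp)]
      exact isBasisOf_path_image _
  | 2 =>
    obtain ⟨β, hβ⟩ := exists_isMiddleChoice G
    refine ⟨cell G R β '' cellPaths G β, ?_, isBasisOf_cell_image hβ⟩
    exact Set.image_subset_iff.2 fun l hl => cell_mem_inductiveElements hβ hl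

end Cells

section DimensionThree

variable {V : Type*} {G : Digraph V} {v : V}

section HeadParts

variable {R : Type*} [CommRing R] {n : ℤ}

theorem mem_of_forall_filter_mem {α β : Type*} [DecidableEq β] {N : Submodule R (α →₀ R)}
    {x : α →₀ R} (f : α → β) (h : ∀ b, x.filter (f · = b) ∈ N) : x ∈ N := by
  have hx : x = ∑ b ∈ x.support.image f, x.filter (f · = b) := by
    ext a
    simp only [Finsupp.finsetSum_apply, Finsupp.filter_apply, Finset.sum_ite_eq]
    split_ifs with ha
    · rfl
    · by_contra h0
      exact ha (Finset.mem_image_of_mem f (Finsupp.mem_support_iff.2 h0))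
  rw [hx]
  exact sum_mem fun b _ => h b

theorem addHead_dropHead {w : Chains V R}
    (hw : w ∈ Finsupp.supported R R {l | l.getLast? = some v}) :
    addHead R v (dropHead V R w) = w := by
  refine map_eq_of_mem_supported (f := addHead R v ∘ₗ dropHead V R) (g := LinearMap.id)
    (fun l hl => ?_) hw
  rw [LinearMap.comp_apply, dropHead_single, addHead_single, List.dropLast_append_getLast? v hl,
    LinearMap.id_apply]

theorem dropHead_mem_joined (hn : 1 ≤ n) {w : Chains V R} (hw : w ∈ allowed G R (n + 1))
    (hv : w ∈ Finsupp.supported R R {l | l.getLast? = some v}) :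
    dropHead V R w ∈ joined G R .upper v := by
  have hw' := Submodule.mem_inf.2 ⟨hw, hv⟩
  rw [allowed, ← Finsupp.supported_inter] at hw'
  refine map_mem_of_mem_supported (S := allowedLists G (n + 1) ∩ {l | l.getLast? = some v})
    (fun l ⟨hl, hlv⟩ => ?_) hw'
  rw [← List.dropLast_append_getLast? v hlv, concat_mem_allowedLists_iff (by omega)] at hl
  rw [dropHead_single]
  exact path_mem_joined_upper hl.2

theorem exists_extend_eq (hG : ∀ v, ¬ G.Adj v v) (hn : 1 ≤ n) {w : Chains V R}
    (hw : w ∈ Omega G R (n + 1)) (hwv : w ∈ Finsupp.supported R R {l | l.getLast? = some v}) :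
    ∃ z ∈ Omega G R n, z ∈ joined G R .upper v ∧ z ∈ unblocked G R .upper v ∧
      extend G R .upper v z = w := by
  have hz : dropHead V R w ∈ allowed G R n := by
    simpa using dropHead_mem_allowed (by omega) hw.1
  have hv : dropHead V R w ∈ joined G R .upper v := dropHead_mem_joined hn hw.1 hwv
  have hext : extend G R .upper v (dropHead V R w) = w := by
    rw [extend_upper_eq_addHead hz hv, addHead_dropHead hwv]
  rw [← hext] at hw
  exact ⟨_, mem_Omega_of_extend_upper_mem_Omega hG hn hz hv hw, hv,
    mem_unblocked_of_extend_upper_mem_Omega hG hn hz hv hw, hext⟩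

theorem Omega_le_of_extend_mem (hG : ∀ v, ¬ G.Adj v v) (hn : 1 ≤ n)
    {N : Submodule R (Chains V R)}
    (hN : ∀ v, ∀ z ∈ Omega G R n, z ∈ joined G R .upper v → z ∈ unblocked G R .upper v →
      extend G R .upper v z ∈ N) : Omega G R (n + 1) ≤ N := by
  classical
  intro x hx
  refine mem_of_forall_filter_mem List.getLast? fun o => ?_
  have hw := filter_getLast?_mem_Omega hx (· = o)
  have hwo : (x.filter fun l => l.getLast? = o) ∈ Finsupp.supported R R {l | l.getLast? = o} :=
    (Finsupp.mem_supported' _ _).2 fun l hl => Finsupp.filter_apply_neg _ _ hl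
  cases o with
  | none =>
    convert N.zero_mem
    refine Finsupp.support_eq_empty.1 (Finset.eq_empty_of_forall_notMem fun l hl => ?_)
    exact (hw.1 hl).1 (List.getLast?_eq_none_iff.1 (hwo hl))
  | some v =>
    obtain ⟨z, hz, hzv, hzu, hext⟩ := exists_extend_eq hG hn hw hwo
    rw [← hext]
    exact hN v z hz hzv hzu

end HeadParts

theorem IsSignedPath.sign_smul {E : Set (Chains V ℤ)} {x : Chains V ℤ} (hx : IsSignedPath E x)
    (a : ℤ) : IsSignedPath E (a.sign • x) := by
  obtain h | h | h := Int.sign_trichotomy a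
  · rwa [h, one_smul]
  · rw [h, zero_smul]
    exact .zero E
  · rw [h, neg_one_smul]
    exact hx.neg

theorem isSignedPath_face_cell {R : Type*} [CommRing R] [CharZero R] {β : V → V → V}
    (hβ : IsMiddleChoice G β) {l : List V} (hl : l ∈ cellPaths G β) (u : V) :
    IsSignedPath (inductiveElements G R .upper 1) (face R .upper u (cell G R β l)) := by
  classical
  obtain ⟨a, b, c, rfl, hab, hbc⟩ := mem_allowedLists_two.1 hl.1
  have hab' := isSignedPath_path (path_pair_mem_inductiveElements (R := R) hab)
  have haβ := isSignedPath_path (path_pair_mem_inductiveElements (R := R) (hβ a b c hab hbc).1)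
  rw [cell_triple hab hbc, map_sub, apply_ite (face R .upper u), map_zero, face_upper_path_triple,
    face_upper_path_triple]
  split_ifs with hbu hb hβu hb hβu
  · exact absurd (by rw [hbu, hβu]) (hl.2 a c hb)
  · rwa [sub_zero]
  · rwa [sub_zero]
  · rw [zero_sub]
    exact haβ.neg
  · rw [sub_zero]
    exact .zero _
  · rw [sub_zero]
    exact .zero _

theorem cell_mem_joined {R : Type*} [CommRing R] {β : V → V → V} {l : List V}
    (hl : l ∈ allowedLists G 2) (hv : ∀ w ∈ l.getLast?, G.Adj w v) :
    cell G R β l ∈ joined G R .upper v := by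
  classical
  obtain ⟨a, b, c, rfl, hab, hbc⟩ := mem_allowedLists_two.1 hl
  have hcv : G.Adj c v := hv c rfl
  rw [cell_triple hab hbc]
  refine sub_mem (path_mem_joined_upper hv) ?_
  split_ifs
  · exact path_mem_joined_upper (by simpa using hcv)
  · exact zero_mem _

section SignedCells

variable {β : V → V → V} {z : Chains V ℤ}

open scoped Classical in
/-- The cells that occur in an element `z` of `Ω_2`, with repetitions: the cell of `l` occurs
`|z l|` times, with the sign of `z l`. -/
noncomputable def signedCells (G : Digraph V) (β : V → V → V) (z : Chains V ℤ)
    (i : Σ l : ({l ∈ z.support | l ∈ cellPaths G β} : Finset (List V)), Fin (z l).natAbs) :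
    Chains V ℤ :=
  (z i.1).sign • cell G ℤ β i.1

theorem sum_signedCells (hz : z ∈ Omega G ℤ 2) : ∑ i, signedCells G β z i = z := by
  classical
  rw [Fintype.sum_sigma]
  simp only [signedCells, Finset.sum_const, Finset.card_univ, Fintype.card_fin]
  conv_rhs => rw [eq_sum_smul_cell hz β]
  rw [Finset.sum_coe_sort _ fun l => (z l).natAbs • (z l).sign • cell G ℤ β l]
  refine Finset.sum_congr rfl fun l _ => ?_
  rw [← natCast_zsmul, smul_smul, mul_comm, Int.sign_mul_natAbs]

open scoped Classical in
theorem isSimpleFamily_signedCells (hβ : IsMiddleChoice G β) (hz : z ∈ joined G ℤ .upper v) :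
    IsSimpleFamily G .upper v (inductiveElements G ℤ .upper 2) (inductiveElements G ℤ .upper 1)
      (signedCells G β z) where
  ne_neg i j _ h := by
    obtain ⟨hi, hil⟩ := Finset.mem_filter.1 i.1.2
    have hsign : (z i.1).sign = 0 := by
      have happly := DFunLike.congr_fun h (i.1 : List V)
      simp only [signedCells, Finsupp.smul_apply, Finsupp.neg_apply, cell_apply hil, path,
        Finsupp.single_apply, if_true, smul_eq_mul, mul_one] at happly
      split_ifs at happly with hij
      · rw [hij] at happly
        omega
      · omega
    exact Finsupp.mem_support_iff.1 hi (Int.sign_eq_zero_iff_zero.1 hsign)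
  mem_or_neg_mem i := by
    obtain ⟨hi, hil⟩ := Finset.mem_filter.1 i.1.2
    have hcell := cell_mem_inductiveElements (R := ℤ) hβ hil
    rw [signedCells]
    rcases lt_or_gt_of_ne (Finsupp.mem_support_iff.1 hi) with h | h
    · rw [Int.sign_eq_neg_one_of_neg h, neg_one_smul, neg_neg]
      exact .inr hcell
    · rw [Int.sign_eq_one_of_pos h, one_smul]
      exact .inl hcell
  isSignedPath_face i u := by
    rw [signedCells, map_zsmul]
    exact (isSignedPath_face_cell hβ (Finset.mem_filter.1 i.1.2).2 u).sign_smul _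
  mem_joined i := by
    obtain ⟨hi, hil⟩ := Finset.mem_filter.1 i.1.2
    exact zsmul_mem (cell_mem_joined hil.1 (hz hi)) _

end SignedCells

theorem Omega_three_le_span_inductiveElements_upper (hG : ∀ v, ¬ G.Adj v v) :
    Omega G ℤ 3 ≤ Submodule.span ℤ (inductiveElements G ℤ .upper 3) := by
  refine Omega_le_of_extend_mem (n := 2) hG (by norm_num) fun v z hz hzv hzu => ?_
  obtain ⟨β, hβ⟩ := exists_isMiddleChoice G
  rw [← sum_signedCells (β := β) hz] at hzu ⊢
  exact (isSimpleFamily_signedCells hβ hzv).extend_sum_mem_span (n := 3)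
    (inductiveElements_subset_Omega G ℤ .upper 2) (inductiveElements_subset_Omega G ℤ .upper 1)
    Finset.univ hzu

end DimensionThree

section BothSides

variable {V : Type*} (G : Digraph V)

theorem exists_isBasisOf_Omega (R : Type*) [CommRing R] [CharZero R] (s : Side) {i : ℕ}
    (hi : i ≤ 2) : ∃ B ⊆ inductiveElements G R s i, IsBasisOf B (Omega G R i) := by
  cases s with
  | upper => exact exists_isBasisOf_Omega_upper G R hi
  | lower => exact exists_isBasisOf_opposite (exists_isBasisOf_Omega_upper (reverseDigraph G) R hi)

theorem span_inductiveElements_of_le_two (R : Type*) [CommRing R] [CharZero R] (s : Side) {i : ℕ}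
    (hi : i ≤ 2) : Submodule.span R (inductiveElements G R s i) = Omega G R i := by
  refine le_antisymm (Submodule.span_le.2 (inductiveElements_subset_Omega G R s i)) ?_
  obtain ⟨B, hB, -, hspan⟩ := exists_isBasisOf_Omega G R s hi
  exact hspan.ge.trans (Submodule.span_mono hB)

theorem span_inductiveElements_three (hG : ∀ v, ¬ G.Adj v v) (s : Side) :
    Submodule.span ℤ (inductiveElements G ℤ s 3) = Omega G ℤ 3 := by
  refine le_antisymm (Submodule.span_le.2 (inductiveElements_subset_Omega G ℤ s 3)) ?_
  cases s with
  | upper => exact Omega_three_le_span_inductiveElements_upper hG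
  | lower =>
    exact Omega_le_span_inductiveElements_opposite (s := .upper) (i := 3)
      (Omega_three_le_span_inductiveElements_upper (G := reverseDigraph G) hG)

end BothSides

end PathHom

theorem mainTheorem2 {V : Type*} (G : Digraph V) (hG : ∀ v, ¬ G.Adj v v)
    (K : Type*) [Field K] [CharZero K] (s : PathHom.Side) :
    (∀ i : ℕ, i ≤ 2 →
      (∃ B ⊆ PathHom.inductiveElements G ℤ s i,
        PathHom.IsBasisOf B (PathHom.Omega G ℤ i)) ∧
      (∃ B ⊆ PathHom.inductiveElements G K s i ∩
          PathHom.ofInt K '' PathHom.inductiveElements G ℤ s i,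
        PathHom.IsBasisOf B (PathHom.Omega G K i))) ∧
    Submodule.span ℤ (PathHom.inductiveElements G ℤ s 3) = PathHom.Omega G ℤ 3 ∧
    (∃ B ⊆ PathHom.inductiveElements G K s 3 ∩
        PathHom.ofInt K '' PathHom.inductiveElements G ℤ s 3,
      PathHom.IsBasisOf B (PathHom.Omega G K 3)) :=
  have hspan := PathHom.span_inductiveElements_three G hG s
  ⟨fun _ hi => ⟨PathHom.exists_isBasisOf_Omega G ℤ s hi,
      PathHom.exists_isBasisOf_of_span_eq K (PathHom.span_inductiveElements_of_le_two G ℤ s hi)⟩,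
    hspan, PathHom.exists_isBasisOf_of_span_eq (i := 3) K hspan⟩
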